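/- Let $d\ge 2$. A generalized principally polarized tropical abelian variety (pptav) consists of finitely generated free abelian groups $\Lambda,\Lambda'$, a pairing $[\cdot,\cdot]:\Lambda\times\Lambda'\to\mathbb R$ and an isomorphism $\zeta:\Lambda'\to\Lambda$ such that $[\zeta(\cdot),\cdot]$ is symmetric and, on $\Lambda'\otimes\mathbb R$, positive semidefinite with rational null space; $A_2^{tr}$ is the set of isomorphism classes of those of rank $2$. Its points are classes $[Q]$ of real symmetric $2\times2$ matrices under $Q\mapsto X^TQX$, $X\in GL_2(\mathbb Z)$. Put $q_{13}=-q_{11}-q_{12}$, $q_{23}=-q_{22}-q_{12}$ and $\sigma=\{Q: q_{12},q_{13},q_{23}\le 0\}$; the boundary $\partial A_2^{tr}$ consists of the classes of the $Q\in\sigma$ with $q_{12}q_{13}q_{23}=0$. The moduli space $M_2^{tr}$ of tropical curves of genus $2$ is obtained from the theta cell $\mathbb R_{\ge0}^3/S_3$ (three edge lengths) and the dumbbell cell $\mathbb R_{\ge 0}^3/S_2$ (two loop lengths up to exchange, and the bridge length) by identifying the theta curve $(a,b,0)$ with the dumbbell curve $(a,b,0)$. The Torelli map $t:M_2^{tr}\to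 A_2^{tr}$ sends a curve to its Jacobian. Call $J$ $d$-split if there are tropical elliptic curves $E',E$ and an isogeny $E'\oplus E\to J$ whose kernel is the graph of an isomorphism $E'[d]\to E[d]$ and which pulls the polarization of $J$ back to $d$ times the product polarization. Let $\mathbb T\mathcal L_d\subset M_2^{tr}$ be the locus of curves with $d$-split Jacobian. For $k\in(\mathbb Z/d)^*$, represented by $1\le k\le d-1$, and $x=(l',l)\in\mathbb R_{>0}^2$ let $$Q_k(x)=\begin{pmatrix} d\,l' & -k\,l'\\ -k\,l' & \frac{k^2l'+l}{d}\end{pmatrix},\qquad L_k=t^{-1}\big(\{[Q_k(x)] : x\in\mathbb R^2_{>0}\}\big).$$ Let $\Delta_k$ be the collection consisting of the closures of the connected components of $\{x\in\mathbb R_{>0}^2:[Q_k(x)]\notin\partial A_2^{tr}\}$ (the maximal cones) and of all faces of these. Selling's algorithm applied to $Q$ with $q_{12}<0$ replaces $Q$ by $X^TQX$ with $X=\begin{pmatrix}1&1\\0&1\end{pmatrix}$ if $q_{13}>0$ and with $X=\begin{pmatrix}1&0\\1&1\end{pmatrix}$ if $q_{23}>0$, and stops when $q_{13},q_{23}\le0$.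 The type of $Q$ is the sequence of moves performed. A type $\tau$ is feasible (for $d,k$) if it is the type of $Q_k(x)$ for some $x\in\mathbb R_{>0}^2$; let $\sigma_\tau$ be the closure of the set of these $x$. **Theorem.** The locus is the union $\mathbb T\mathcal L_d=\bigcup_{k\in(\mathbb Z/d)^*}L_k$ of $\varphi(d)$ (not necessarily distinct) pieces. For each $k$, $\Delta_k$ is a finite rational polyhedral fan with support $\mathbb R_{\ge0}^2$, and $\tau\mapsto\sigma_\tau$ is a bijection from the feasible types to the maximal cones of $\Delta_k$. There are linear maps $\phi_\tau:\mathbb R^2\to\mathbb R^3$, one for each feasible type $\tau$, that map $\sigma_\tau$ into $\mathbb R_{\ge0}^3$, and hence, regarding values as edge lengths of theta curves, define maps $\sigma_\tau\to M_2^{tr}$, such that: 1. $\phi_\tau$ maps the interior of $\sigma_\tau$ into $\mathbb R_{>0}^3$, and its image there spans a space of dimension $2$; for $x$ in the interior of $\sigma_\tau$, $t^{-1}([Q_k(x)])$ consists of the theta curve $\phi_\tau(x)$ alone. 2. Let $r$ be a ray that is a face of two maximal cones $\sigma_\tau\ne\sigma_{\tau'}$. Then one coordinate of $\phi_\tau$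 vanishes on $r$, and the other two, $a$ and $b$, are positive on $r\setminus\{0\}$. For $x\in r$ the theta curve $\phi_\tau(x)$ is the dumbbell curve with loops $a(x),b(x)$ and bridge length $0$, and for $x\in r\setminus\{0\}$ the fibre $t^{-1}([Q_k(x)])$ is the set of the dumbbell curves with loops $a(x),b(x)$ and arbitrary bridge length $s\ge0$. So $(x,s)\mapsto(a(x),b(x),s)$ is the map $\phi_\tau|_r\times\mathrm{id}: r\times\mathbb R_{\ge0}\to M_2^{tr}$, with image $\phi_\tau(r)\times r_B$ in the dumbbell part, where $r_B$ is the ray of the bridge length. 3. For all feasible $\tau,\tau'$ the maps $\sigma_\tau\to M_2^{tr}$ and $\sigma_{\tau'}\to M_2^{tr}$ agree on $\sigma_\tau\cap\sigma_{\tau'}$. -/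

import Mathlib

open scoped NNReal

/-! ### Principally polarized tropical abelian varieties -/

/-- A principally polarized tropical abelian variety, in the generalized sense that is needed for
moduli spaces: lattices `Λ`, `Λ'` with a real pairing, and a principal polarization
`ζ : Λ' ≃ Λ` whose bilinear form `[ζ(·), ·]` on `Λ'` is symmetric, and on `Λ' ⊗ ℝ` is positive
semidefinite with rational null space. The last two conditions together say exactly that the
values `[ζ x, x]`, `x ∈ Λ'`, are `0` or bounded below by a positive constant. -/
structure PPTav where
  Λ : Type
  Λ' : Type
  [addΛ : AddCommGroup Λ]
  [addΛ' : AddCommGroup Λ']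
  [freeΛ : Module.Free ℤ Λ]
  [freeΛ' : Module.Free ℤ Λ']
  [finΛ : Module.Finite ℤ Λ]
  [finΛ' : Module.Finite ℤ Λ']
  pairing : Λ →ₗ[ℤ] Λ' →ₗ[ℤ] ℝ
  ζ : Λ' ≃ₗ[ℤ] Λ
  symm : ∀ x y, pairing (ζ x) y = pairing (ζ y) x
  gap : ∃ ε : ℝ, 0 < ε ∧ ∀ x, pairing (ζ x) x = 0 ∨ ε ≤ pairing (ζ x) x

namespace PPTav

attribute [instance] addΛ addΛ' freeΛ freeΛ' finΛ finΛ'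

/-- The symmetric bilinear form `[ζ(·), ·]` on `Λ'`. -/
def form (T : PPTav) (x y : T.Λ') : ℝ := T.pairing (T.ζ x) y

/-- The dimension, i.e. the common rank of the two lattices. -/
noncomputable def dim (T : PPTav) : ℕ := Module.finrank ℤ T.Λ'

/-- A morphism `T₁ → T₂` of integral tori: `sharp : Λ₂ → Λ₁` and `flat : Λ₁' → Λ₂'`, adjoint with
respect to the pairings. -/
structure Hom (T₁ T₂ : PPTav) where
  sharp : T₂.Λ →ₗ[ℤ] T₁.Λ
  flat : T₁.Λ' →ₗ[ℤ] T₂.Λ'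
  compat : ∀ x y, T₁.pairing (sharp x) y = T₂.pairing x (flat y)

/-- An isogeny is a surjective (`sharp` injective) and finite (`flat` injective) morphism. -/
def Hom.IsIsogeny {T₁ T₂ : PPTav} (f : Hom T₁ T₂) : Prop :=
  Function.Injective f.sharp ∧ Function.Injective f.flat

/-- Isomorphism of principally polarized tropical abelian varieties: an isomorphism of integral
tori under which the polarization of the target pulls back to that of the source. -/
def Iso (T₁ T₂ : PPTav) : Prop :=
  ∃ f : Hom T₁ T₂, Function.Bijective f.sharp ∧ Function.Bijective f.flat ∧
    ∀ x, f.sharp (T₂.ζ (f.flat x)) = T₁.ζ x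

/-- An isometry of the lattices `Λ'` extends to an isomorphism. -/
theorem iso_of_isometry {T₁ T₂ : PPTav} (g : T₁.Λ' ≃ₗ[ℤ] T₂.Λ')
    (h : ∀ x y, T₂.form (g x) (g y) = T₁.form x y) : Iso T₁ T₂ := by
  refine ⟨⟨(T₂.ζ.symm.trans (g.symm.trans T₁.ζ)).toLinearMap, g.toLinearMap, ?_⟩,
    (T₂.ζ.symm.trans (g.symm.trans T₁.ζ)).bijective, g.bijective, ?_⟩
  · intro x y
    have := h (g.symm (T₂.ζ.symm x)) y
    simpa [form] using this.symm
  · intro x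
    simp

theorem isometry_of_iso {T₁ T₂ : PPTav} (h : Iso T₁ T₂) :
    ∃ g : T₁.Λ' ≃ₗ[ℤ] T₂.Λ', ∀ x y, T₂.form (g x) (g y) = T₁.form x y := by
  obtain ⟨f, -, hf, hp⟩ := h
  refine ⟨LinearEquiv.ofBijective f.flat hf, fun x y => ?_⟩
  have := f.compat (T₂.ζ (f.flat x)) y
  rw [hp] at this
  exact this.symm

theorem iso_equivalence : Equivalence Iso where
  refl T := iso_of_isometry (LinearEquiv.refl ℤ _) fun _ _ => rfl
  symm h := by
    obtain ⟨g, hg⟩ := isometry_of_iso h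
    refine iso_of_isometry g.symm fun x y => ?_
    rw [← hg, g.apply_symm_apply, g.apply_symm_apply]
  trans h₁ h₂ := by
    obtain ⟨g₁, h₁⟩ := isometry_of_iso h₁
    obtain ⟨g₂, h₂⟩ := isometry_of_iso h₂
    exact iso_of_isometry (g₁.trans g₂) fun x y => by simp [h₁, h₂]

theorem form_nonneg (T : PPTav) (x : T.Λ') : 0 ≤ T.form x x := by
  obtain ⟨ε, hε, h⟩ := T.gap
  rcases h x with h | h
  · exact h.ge
  · exact hε.le.trans h

/-- The tropical elliptic curve `ℝ / lℤ` of length `l`, with its principal polarization. -/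
noncomputable def elliptic (l : ℝ) (hl : 0 < l) : PPTav where
  Λ := ℤ
  Λ' := ℤ
  pairing := LinearMap.mk₂ ℤ (fun a b : ℤ => l * a * b)
    (by intros; push_cast; ring) (by intros; simp; ring)
    (by intros; push_cast; ring) (by intros; simp; ring)
  ζ := LinearEquiv.refl ℤ ℤ
  symm x y := by simp; ring
  gap := by
    refine ⟨l, hl, fun x => ?_⟩
    rcases eq_or_ne x 0 with rfl | hx
    · left; simp
    · right
      have : (1 : ℝ) ≤ (x : ℝ) * x := by exact_mod_cast Int.add_one_le_iff.2 (mul_self_pos.2 hx)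
      simp only [LinearEquiv.refl_apply, LinearMap.mk₂_apply, mul_assoc]
      nlinarith

/-- The (co)product of two principally polarized tropical abelian varieties, with the product
polarization. -/
noncomputable def prod (T₁ T₂ : PPTav) : PPTav where
  Λ := T₁.Λ × T₂.Λ
  Λ' := T₁.Λ' × T₂.Λ'
  pairing := LinearMap.mk₂ ℤ (fun a b => T₁.pairing a.1 b.1 + T₂.pairing a.2 b.2)
    (by intros; simp; ring) (by intros; simp)
    (by intros; simp; ring) (by intros; simp)
  ζ := T₁.ζ.prodCongr T₂.ζ
  symm x y := by simp [T₁.symm x.1 y.1, T₂.symm x.2 y.2]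
  gap := by
    obtain ⟨ε₁, h₁, H₁⟩ := T₁.gap
    obtain ⟨ε₂, h₂, H₂⟩ := T₂.gap
    refine ⟨min ε₁ ε₂, lt_min h₁ h₂, fun x => ?_⟩
    have n₁ := T₁.form_nonneg x.1
    have n₂ := T₂.form_nonneg x.2
    simp only [form] at n₁ n₂
    have m₁ := min_le_left ε₁ ε₂
    have m₂ := min_le_right ε₁ ε₂
    simp only [LinearEquiv.prodCongr_apply, LinearMap.mk₂_apply]
    rcases H₁ x.1 with a | a <;> rcases H₂ x.2 with b | b
    · left; linarith
    all_goals right; linarith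

/-- The canonical injections `T₁ → T₁ ⊕ T₂` and `T₂ → T₁ ⊕ T₂`. -/
noncomputable def inl (T₁ T₂ : PPTav) : Hom T₁ (prod T₁ T₂) where
  sharp := LinearMap.fst ℤ T₁.Λ T₂.Λ
  flat := LinearMap.inl ℤ T₁.Λ' T₂.Λ'
  compat x y := by
    change T₁.pairing x.1 y = T₁.pairing x.1 y + T₂.pairing x.2 0
    rw [map_zero, add_zero]

noncomputable def inr (T₁ T₂ : PPTav) : Hom T₂ (prod T₁ T₂) where
  sharp := LinearMap.snd ℤ T₁.Λ T₂.Λ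
  flat := LinearMap.inr ℤ T₁.Λ' T₂.Λ'
  compat x y := by
    change T₂.pairing x.2 y = T₁.pairing x.1 0 + T₂.pairing x.2 y
    rw [map_zero, zero_add]

/-- The group of points `Hom(Λ, ℝ) / Λ'`, where `Λ' → Hom(Λ, ℝ)` is given by the pairing. -/
abbrev Points (T : PPTav) : Type :=
  (T.Λ →ₗ[ℤ] ℝ) ⧸ LinearMap.range T.pairing.flip

/-- The homomorphism induced on points. -/
noncomputable def Hom.onPoints {T₁ T₂ : PPTav} (f : Hom T₁ T₂) : T₁.Points →ₗ[ℤ] T₂.Points :=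
  Submodule.mapQ _ _ (LinearMap.lcomp ℤ ℝ f.sharp) (by
    rintro _ ⟨y, rfl⟩
    refine ⟨f.flat y, ?_⟩
    ext x
    simp [f.compat])

/-- The group of `d`-torsion points. -/
abbrev Torsion (T : PPTav) (d : ℕ) : Type := Submodule.torsionBy ℤ T.Points (d : ℤ)

/-- `J` is `d`-split: there are tropical elliptic curves `E'`, `E` and an isogeny
`f : E' ⊕ E → J` whose kernel is the graph of an isomorphism `E'[d] → E[d]` and which pulls the
polarization of `J` back to `d` times the product polarization. -/
def IsDSplit (d : ℕ) (J : PPTav) : Prop :=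
  ∃ (l' l : ℝ) (hl' : 0 < l') (hl : 0 < l) (f : Hom (prod (elliptic l' hl') (elliptic l hl)) J)
    (α : (elliptic l' hl').Torsion d ≃+ (elliptic l hl).Torsion d),
    f.IsIsogeny ∧
    (∀ x, f.sharp (J.ζ (f.flat x)) = (d : ℤ) • (prod (elliptic l' hl') (elliptic l hl)).ζ x) ∧
    ((LinearMap.ker f.onPoints : Set _) =
      Set.range fun P : (elliptic l' hl').Torsion d =>
        (inl (elliptic l' hl') (elliptic l hl)).onPoints P +
          (inr (elliptic l' hl') (elliptic l hl)).onPoints (α P))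

/-- `Q` is the matrix of the form `[ζ(·), ·]` in some `ℤ`-basis of `Λ'`. -/
def HasMatrix (T : PPTav) (Q : Matrix (Fin 2) (Fin 2) ℝ) : Prop :=
  ∃ b : Module.Basis (Fin 2) ℤ T.Λ', ∀ i j, T.form (b i) (b j) = Q i j

end PPTav

/-! ### The moduli space `A₂ᵗʳ` -/

instance pptavSetoid : Setoid {T : PPTav // T.dim = 2} where
  r S T := PPTav.Iso S.1 T.1
  iseqv := ⟨fun _ => PPTav.iso_equivalence.refl _, fun h => PPTav.iso_equivalence.symm h,
    fun h₁ h₂ => PPTav.iso_equivalence.trans h₁ h₂⟩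

/-- The points of `A₂ᵗʳ`: isomorphism classes of principally polarized tropical abelian varieties
of dimension `2`. -/
def A2tr : Type 1 := Quotient pptavSetoid

/-- `a` is the class in `A₂ᵗʳ = S̃²_{≥0} / GL₂(ℤ)` of the matrix `Q`. -/
def IsClassOf (Q : Matrix (Fin 2) (Fin 2) ℝ) (a : A2tr) : Prop :=
  ∃ T : {T : PPTav // T.dim = 2}, Quotient.mk pptavSetoid T = a ∧ T.1.HasMatrix Q

/-- The Selling parameters `q₁₃ = -q₁₁ - q₁₂` and `q₂₃ = -q₂₂ - q₁₂` of a symmetric matrix. -/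
def selling13 (Q : Matrix (Fin 2) (Fin 2) ℝ) : ℝ := -Q 0 0 - Q 0 1

def selling23 (Q : Matrix (Fin 2) (Fin 2) ℝ) : ℝ := -Q 1 1 - Q 0 1

/-- The cone `σ` spanned by `(1 0; 0 0)`, `(0 0; 0 1)` and `(1 -1; -1 1)`. -/
def sigmaCone : Set (Matrix (Fin 2) (Fin 2) ℝ) :=
  {Q | Q.IsSymm ∧ Q 0 1 ≤ 0 ∧ selling13 Q ≤ 0 ∧ selling23 Q ≤ 0}

/-- The boundary of `A₂ᵗʳ`: the classes of matrices in a proper face of `σ`. -/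
def boundaryA2tr : Set A2tr :=
  {a | ∃ Q ∈ sigmaCone, (Q 0 1 = 0 ∨ selling13 Q = 0 ∨ selling23 Q = 0) ∧ IsClassOf Q a}

/-! ### Metric graphs, their Jacobians, and the moduli space `M₂ᵗʳ` -/

/-- A finite oriented multigraph. -/
structure OrientedGraph (V E : Type) where
  src : E → V
  tgt : E → V

namespace OrientedGraph

variable {V E : Type} [Fintype E] [DecidableEq V]

/-- The lattice `H₁(G, ℤ)` of integral cycles. The condition on the coefficients is also the one
that defines integral harmonic `1`-forms. -/
def cycles (G : OrientedGraph V E) : Submodule ℤ (E → ℤ) where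
  carrier := {c | ∀ v, ∑ e, (if G.tgt e = v then c e else 0) = ∑ e, (if G.src e = v then c e else 0)}
  add_mem' {a b} ha hb v := by
    simp only [Pi.add_apply, ite_add_zero, Finset.sum_add_distrib, ha v, hb v]
  zero_mem' v := by simp
  smul_mem' n a ha v := by
    simp only [Pi.smul_apply, smul_eq_mul, ← mul_ite_zero, ← Finset.mul_sum, ha v]

/-- The Jacobian of a metric graph: harmonic `1`-forms, cycles, the integration pairing, and the
polarization `∑ aₑ e ↦ ∑ aₑ de`. Edges of length `0` are allowed; they stand for the curve
obtained by contracting them (contracted cycles turning into vertex genus), whose generalized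
Jacobian this is. -/
noncomputable def jac (G : OrientedGraph V E) (len : E → ℝ≥0) : PPTav where
  Λ := G.cycles
  Λ' := G.cycles
  pairing := LinearMap.mk₂ ℤ
    (fun ω c : G.cycles => ∑ e, (len e : ℝ) * ((ω : E → ℤ) e : ℝ) * ((c : E → ℤ) e : ℝ))
    (by intros; simp only [← Finset.sum_add_distrib]
        refine Finset.sum_congr rfl fun e _ => ?_
        simp only [Submodule.coe_add, Pi.add_apply]; push_cast; ring)
    (by intros; rw [Finset.smul_sum]
        refine Finset.sum_congr rfl fun e _ => ?_
        simp only [Submodule.coe_smul, Pi.smul_apply, zsmul_eq_mul, smul_eq_mul]; push_cast; ring)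
    (by intros; simp only [← Finset.sum_add_distrib]
        refine Finset.sum_congr rfl fun e _ => ?_
        simp only [Submodule.coe_add, Pi.add_apply]; push_cast; ring)
    (by intros; rw [Finset.smul_sum]
        refine Finset.sum_congr rfl fun e _ => ?_
        simp only [Submodule.coe_smul, Pi.smul_apply, zsmul_eq_mul, smul_eq_mul]; push_cast; ring)
  ζ := LinearEquiv.refl ℤ _
  symm x y := by
    simp only [LinearEquiv.refl_apply, LinearMap.mk₂_apply]
    exact Finset.sum_congr rfl fun e _ => by ring
  gap := by
    obtain ⟨ε, hε, h⟩ : ∃ ε : ℝ, 0 < ε ∧ ∀ e, len e = 0 ∨ ε ≤ len e := by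
      have key : ∀ s : Finset E, ∃ ε : ℝ, 0 < ε ∧ ∀ e ∈ s, len e = 0 ∨ ε ≤ len e := by
        classical
        intro s
        induction s using Finset.induction_on with
        | empty => exact ⟨1, one_pos, by simp⟩
        | insert a s _ ih =>
          obtain ⟨ε, hε, h⟩ := ih
          rcases eq_or_ne (len a) 0 with ha | ha
          · refine ⟨ε, hε, fun e he => ?_⟩
            rcases Finset.mem_insert.1 he with rfl | he
            · exact Or.inl ha
            · exact h e he
          · have hpos : (0 : ℝ) < len a := by exact_mod_cast pos_iff_ne_zero.2 ha
            refine ⟨min ε (len a), lt_min hε hpos, fun e he => ?_⟩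
            rcases Finset.mem_insert.1 he with rfl | he
            · exact Or.inr (min_le_right _ _)
            · exact (h e he).imp id fun h => (min_le_left _ _).trans h
      obtain ⟨ε, hε, h⟩ := key Finset.univ
      exact ⟨ε, hε, fun e => h e (Finset.mem_univ e)⟩
    refine ⟨ε, hε, fun x => ?_⟩
    simp only [LinearEquiv.refl_apply, LinearMap.mk₂_apply]
    have hnn : ∀ e ∈ Finset.univ, 0 ≤ (len e : ℝ) * ((x : E → ℤ) e : ℝ) * ((x : E → ℤ) e : ℝ) :=
      fun e _ => by rw [mul_assoc]; exact mul_nonneg (len e).2 (mul_self_nonneg _)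
    by_cases hz : ∀ e, len e = 0 ∨ (x : E → ℤ) e = 0
    · left
      refine Finset.sum_eq_zero fun e _ => ?_
      rcases hz e with h | h <;> simp [h]
    · right
      push Not at hz
      obtain ⟨e, he, hx⟩ := hz
      refine le_trans ?_ (Finset.single_le_sum hnn (Finset.mem_univ e))
      have h1 : (1 : ℝ) ≤ ((x : E → ℤ) e : ℝ) * ((x : E → ℤ) e : ℝ) := by
        exact_mod_cast Int.add_one_le_iff.2 (mul_self_pos.2 hx)
      have h2 := (h e).resolve_left he
      nlinarith

end OrientedGraph

/-- The two maximal combinatorial types of tropical curves of genus `2`. -/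
inductive GenusTwoType
  | theta
  | dumbbell

/-- Both types have two vertices and three edges. In the theta graph, the three edges join the two
vertices; in the dumbbell graph, the edges `0` and `1` are loops, one at each vertex, and the
edge `2` is the bridge. -/
def GenusTwoType.graph : GenusTwoType → OrientedGraph (Fin 2) (Fin 3)
  | theta => ⟨![0, 0, 0], ![1, 1, 1]⟩
  | dumbbell => ⟨![0, 1, 0], ![0, 1, 1]⟩

/-- A point of one of the two closed maximal cells `ℝ_{≥0}³` of `M₂ᵗʳ`. -/
structure CurveTwo where
  type : GenusTwoType
  len : Fin 3 → ℝ≥0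

/-- The identifications that define `M₂ᵗʳ`: the automorphism groups of the theta graph (all
permutations of the edges) and of the dumbbell graph (the two loops can be exchanged) act on the
cells, and the cells are glued along the curves with an edge, respectively the bridge,
contracted. (All stable types of genus `2` are specializations of the two maximal types.) -/
inductive Glue : CurveTwo → CurveTwo → Prop
  | thetaAut (π : Equiv.Perm (Fin 3)) (l : Fin 3 → ℝ≥0) : Glue ⟨.theta, l⟩ ⟨.theta, l ∘ π⟩
  | dumbbellAut (l : Fin 3 → ℝ≥0) : Glue ⟨.dumbbell, l⟩ ⟨.dumbbell, l ∘ Equiv.swap 0 1⟩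
  | contract (l : Fin 3 → ℝ≥0) (h : l 2 = 0) : Glue ⟨.theta, l⟩ ⟨.dumbbell, l⟩

/-- The points of the moduli space `M₂ᵗʳ` of tropical curves of genus `2`. -/
def M2tr : Type := Quot Glue

/-- The curve of type theta, respectively dumbbell, with the given edge lengths. -/
def thetaCurve (l : Fin 3 → ℝ≥0) : M2tr := Quot.mk Glue ⟨.theta, l⟩

def dumbbellCurve (l : Fin 3 → ℝ≥0) : M2tr := Quot.mk Glue ⟨.dumbbell, l⟩

/-- The Jacobian of a curve. -/
noncomputable def CurveTwo.jac (Γ : CurveTwo) : PPTav := Γ.type.graph.jac Γ.len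


theorem mem_cycles_theta (c : Fin 3 → ℤ) :
    c ∈ GenusTwoType.theta.graph.cycles ↔ c 0 + c 1 + c 2 = 0 := by
  change (∀ v, _) ↔ _
  simp [Fin.forall_fin_two, GenusTwoType.graph, Fin.sum_univ_three]
  omega

theorem mem_cycles_dumbbell (c : Fin 3 → ℤ) :
    c ∈ GenusTwoType.dumbbell.graph.cycles ↔ c 2 = 0 := by
  change (∀ v, _) ↔ _
  simp [Fin.forall_fin_two, GenusTwoType.graph, Fin.sum_univ_three]

/-- Coordinates on the cycle lattices. -/
def thetaEquiv : GenusTwoType.theta.graph.cycles ≃ₗ[ℤ] (ℤ × ℤ) where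
  toFun c := (c.1 0, c.1 1)
  invFun p := ⟨![p.1, p.2, -p.1 - p.2], (mem_cycles_theta _).2 (by simp)⟩
  map_add' _ _ := rfl
  map_smul' _ _ := rfl
  left_inv c := by
    have := (mem_cycles_theta _).1 c.2
    ext i
    fin_cases i <;> simp
    linarith
  right_inv p := by simp

def dumbbellEquiv : GenusTwoType.dumbbell.graph.cycles ≃ₗ[ℤ] (ℤ × ℤ) where
  toFun c := (c.1 0, c.1 1)
  invFun p := ⟨![p.1, p.2, 0], (mem_cycles_dumbbell _).2 (by simp)⟩
  map_add' _ _ := rfl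
  map_smul' _ _ := rfl
  left_inv c := by
    have := (mem_cycles_dumbbell _).1 c.2
    ext i
    fin_cases i <;> simp [this]
  right_inv p := by simp

theorem CurveTwo.dim_jac (Γ : CurveTwo) : Γ.jac.dim = 2 := by
  obtain ⟨t, l⟩ := Γ
  have h : Module.finrank ℤ (ℤ × ℤ) = 2 := by simp
  cases t
  · exact (LinearEquiv.finrank_eq thetaEquiv).trans h
  · exact (LinearEquiv.finrank_eq dumbbellEquiv).trans h

theorem CurveTwo.form_jac (Γ : CurveTwo) (x y : Γ.type.graph.cycles) :
    Γ.jac.form x y = ∑ e, (Γ.len e : ℝ) * (x.1 e : ℝ) * (y.1 e : ℝ) := rfl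

/-- Permuting the coordinates, for a permutation that preserves the cycle lattice. -/
def permEquiv (t : GenusTwoType) (π : Equiv.Perm (Fin 3))
    (h : ∀ c, c ∈ t.graph.cycles ↔ c ∘ π ∈ t.graph.cycles) :
    t.graph.cycles ≃ₗ[ℤ] t.graph.cycles where
  toFun c := ⟨c.1 ∘ π, (h _).1 c.2⟩
  invFun c := ⟨c.1 ∘ π.symm, (h _).2 (by simp [Function.comp_assoc])⟩
  map_add' _ _ := rfl
  map_smul' _ _ := rfl
  left_inv c := by ext i; simp
  right_inv c := by ext i; simp

theorem iso_perm (t : GenusTwoType) (π : Equiv.Perm (Fin 3))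
    (h : ∀ c, c ∈ t.graph.cycles ↔ c ∘ π ∈ t.graph.cycles) (l : Fin 3 → ℝ≥0) :
    PPTav.Iso (CurveTwo.jac ⟨t, l⟩) (CurveTwo.jac ⟨t, l ∘ π⟩) := by
  refine PPTav.iso_of_isometry (permEquiv t π h) fun x y => ?_
  exact Equiv.sum_comp π fun e => (l e : ℝ) * (x.1 e : ℝ) * (y.1 e : ℝ)

/-- Curves that are identified in `M₂ᵗʳ` have isomorphic Jacobians. -/
theorem Glue.iso_jac {Γ Γ' : CurveTwo} (h : Glue Γ Γ') : PPTav.Iso Γ.jac Γ'.jac := by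
  cases h with
  | thetaAut π l =>
    refine iso_perm _ π (fun c => ?_) l
    have := Equiv.sum_comp π c
    simp only [Fin.sum_univ_three] at this
    simp only [mem_cycles_theta, Function.comp, this]
  | dumbbellAut l =>
    refine iso_perm _ _ (fun c => ?_) l
    simp only [mem_cycles_dumbbell, Function.comp]
    rw [Equiv.swap_apply_of_ne_of_ne (by decide) (by decide)]
  | contract l h =>
    have key : ∀ x y : GenusTwoType.theta.graph.cycles,
        ∑ e, (l e : ℝ) * ((dumbbellEquiv.symm (thetaEquiv x)).1 e : ℝ) *
          ((dumbbellEquiv.symm (thetaEquiv y)).1 e : ℝ) =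
        ∑ e, (l e : ℝ) * (x.1 e : ℝ) * (y.1 e : ℝ) := fun x y => by
      simp [Fin.sum_univ_three, h, thetaEquiv, dumbbellEquiv]
    exact PPTav.iso_of_isometry (thetaEquiv.trans dumbbellEquiv.symm) key

/-- The tropical Torelli map `t₂ᵗʳ : M₂ᵗʳ → A₂ᵗʳ`, which sends a curve to its Jacobian. -/
noncomputable def torelli : M2tr → A2tr :=
  Quot.lift (fun Γ => Quotient.mk pptavSetoid ⟨Γ.jac, Γ.dim_jac⟩)
    fun _ _ h => Quotient.sound (s := pptavSetoid) h.iso_jac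

/-- The fibre of the Torelli map over the class of `Q`. -/
def torelliFibre (Q : Matrix (Fin 2) (Fin 2) ℝ) : Set M2tr := {m | IsClassOf Q (torelli m)}

/-! ### The locus of curves with `d`-split Jacobian -/

/-- The locus of curves with `d`-split Jacobian. -/
def splitLocus (d : ℕ) : Set M2tr :=
  torelli ⁻¹' {a | ∃ T : {T : PPTav // T.dim = 2}, Quotient.mk pptavSetoid T = a ∧ T.1.IsDSplit d}

/-- The matrix of the quotient of `E' ⊕ E` by the graph of the isomorphism of `d`-torsion groups
that is given by `k`, where `E'` and `E` have the lengths `x.1` and `x.2` and `k` is represented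
by an integer in `{1, …, d - 1}`. -/
noncomputable def Qpp (d : ℕ) (k : (ZMod d)ˣ) (x : ℝ × ℝ) : Matrix (Fin 2) (Fin 2) ℝ :=
  !![d * x.1, -((k : ZMod d).val * x.1);
    -((k : ZMod d).val * x.1), ((k : ZMod d).val ^ 2 * x.1 + x.2) / d]

def openQuadrant : Set (ℝ × ℝ) := {x | 0 < x.1 ∧ 0 < x.2}

def closedQuadrant : Set (ℝ × ℝ) := {x | 0 ≤ x.1 ∧ 0 ≤ x.2}

/-- The piece `L_k` of the locus, the preimage under the Torelli map of the set `𝒬_{d,k}` of the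
classes of the matrices `Qpp d k x`. -/
def splitPiece (d : ℕ) (k : (ZMod d)ˣ) : Set M2tr :=
  torelli ⁻¹' {a | ∃ x ∈ openQuadrant, IsClassOf (Qpp d k x) a}

/-! ### Selling reduction and its types -/

/-- The two moves of Selling's reduction algorithm. -/
inductive SellingMove
  | alpha
  | beta

def SellingMove.matrix : SellingMove → Matrix (Fin 2) (Fin 2) ℝ
  | alpha => !![1, 0; 1, 1]
  | beta => !![1, 1; 0, 1]

/-- `HasSellingType Q w`: Selling's reduction algorithm, applied to `Q` (with `q₁₂ < 0`), performs
the moves of the list `w` one after the other and then stops. A list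
`α^{α₁} β^{β₁} ⋯ α^{αₙ} β^{βₙ}` stands for the type `(α₁, β₁, …, αₙ, βₙ)`. -/
inductive HasSellingType : Matrix (Fin 2) (Fin 2) ℝ → List SellingMove → Prop
  | reduced (Q) : selling13 Q ≤ 0 → selling23 Q ≤ 0 → HasSellingType Q []
  | beta (Q w) : 0 < selling13 Q →
      HasSellingType (SellingMove.beta.matrix.transpose * Q * SellingMove.beta.matrix) w →
      HasSellingType Q (.beta :: w)
  | alpha (Q w) : 0 < selling23 Q →
      HasSellingType (SellingMove.alpha.matrix.transpose * Q * SellingMove.alpha.matrix) w →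
      HasSellingType Q (.alpha :: w)

/-- The lengths for which the Selling type is `w`. -/
def typeRegion (d : ℕ) (k : (ZMod d)ˣ) (w : List SellingMove) : Set (ℝ × ℝ) :=
  {x ∈ openQuadrant | HasSellingType (Qpp d k x) w}

/-- A type is feasible for `d` and `k` if it occurs. -/
def IsFeasible (d : ℕ) (k : (ZMod d)ˣ) (w : List SellingMove) : Prop :=
  (typeRegion d k w).Nonempty

/-- The cone `σ_w` of a feasible type `w`. -/
def typeCone (d : ℕ) (k : (ZMod d)ˣ) (w : List SellingMove) : Set (ℝ × ℝ) :=
  closure (typeRegion d k w)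

/-! ### Fans -/

/-- `F` is a face of the cone `C`. -/
def IsFace (F C : Set (ℝ × ℝ)) : Prop :=
  ∃ f : ℝ × ℝ →ₗ[ℝ] ℝ, (∀ x ∈ C, 0 ≤ f x) ∧ F = {x ∈ C | f x = 0}

/-- `C` is a strongly convex rational polyhedral cone. -/
def IsRationalCone (C : Set (ℝ × ℝ)) : Prop :=
  (∃ (n : ℕ) (v : Fin n → ℤ × ℤ),
    C = {x | ∃ a : Fin n → ℝ, (∀ i, 0 ≤ a i) ∧ x = ∑ i, a i • (((v i).1 : ℝ), ((v i).2 : ℝ))}) ∧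
  ∀ x ∈ C, -x ∈ C → x = 0

/-- A (finite, rational polyhedral) fan in `ℝ²`. -/
structure IsFan (Δ : Set (Set (ℝ × ℝ))) : Prop where
  finite : Δ.Finite
  cone : ∀ C ∈ Δ, IsRationalCone C
  face : ∀ C ∈ Δ, ∀ F, IsFace F C → F ∈ Δ
  inter : ∀ C ∈ Δ, ∀ D ∈ Δ, IsFace (C ∩ D) C ∧ IsFace (C ∩ D) D

/-- The lengths for which the matrix `Qpp d k x` lies in the boundary of `A₂ᵗʳ`. -/
def walls (d : ℕ) (k : (ZMod d)ˣ) : Set (ℝ × ℝ) :=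
  {x ∈ openQuadrant | ∃ a ∈ boundaryA2tr, IsClassOf (Qpp d k x) a}

/-- The maximal cones of `Δ_k`: the closures of the pieces into which the walls subdivide the open
quadrant. -/
def maximalCones (d : ℕ) (k : (ZMod d)ˣ) : Set (Set (ℝ × ℝ)) :=
  {C | ∃ x ∈ openQuadrant \ walls d k,
    C = closure (connectedComponentIn (openQuadrant \ walls d k) x)}

/-- The fan `Δ_k`: the maximal cones and their faces. -/
def splitFan (d : ℕ) (k : (ZMod d)ˣ) : Set (Set (ℝ × ℝ)) :=
  {F | ∃ C ∈ maximalCones d k, IsFace F C}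

/-! Three facts combine: a lattice description of `d`-split Jacobians, a Torelli statement for theta
curves, and the observation that Selling's algorithm on `Qpp d k x` is a subtractive Euclidean
algorithm whose moves do not depend on `x`.

Lattices. If `f : E' ⊕ E → J` pulls the polarization back to `d` times the product, then conjugating
`f.sharp` by the polarizations gives an embedding of `Λ'(J)` into `ℤ²` under which `d` times the
form of `J` is the product form. The kernel of `f` on points is this sublattice divided by `d`. It
is the graph of multiplication by `-k⁻¹` exactly when the sublattice is `{(a, b) : a + k b ≡ 0 mod
d}`, which has the basis `(d, 0)`, `(-k, 1)`; the Gram matrix of this basis is `Qpp d k x`. The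
construction can be reversed.

Torelli. The three nonzero classes of the cycle lattice of a theta graph modulo `2` have the minima
`l₁ + l₂`, `l₀ + l₂`, `l₀ + l₁`, so the Jacobian determines the lengths up to order
(`eq_comp_perm_of_iso`). A dumbbell has the Jacobian of the theta curve with the loops as two edges
and a third edge of length `0`; its bridge is invisible. This gives all the fibres, identifies the
walls as the places where a length vanishes, and makes the maps of different types agree where their
cones meet.

Reduction. Embed `ℤ²` by the diagonal coordinates above and write a basis as `(p₁, s₁)`, `(-p₂, s₂)`
with nonnegative entries. Only one of the two outer Selling parameters can be positive, and which
one depends on the sign of `p₁ - p₂` alone. Hence every type is an initial segment of one word, and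
`x` only decides when to stop: as soon as the next basis is no longer obtuse. The rays on which the
successive bases are orthogonal turn strictly clockwise, from the second axis until `p₂ = 0`, where
the first axis is reached. They cut the quadrant into finitely many sectors. On the `n`-th sector
the `n`-th state gives nonnegative lengths, all positive inside; on a ray between two sectors
exactly one of them vanishes. -/

/-! ### Gram matrices and points of `A₂ᵗʳ` -/

namespace PPTav

/-- The form `[ζ(·), ·]` as a bilinear map. -/
noncomputable def bilin (T : PPTav) : T.Λ' →ₗ[ℤ] T.Λ' →ₗ[ℤ] ℝ := T.pairing ∘ₗ T.ζ.toLinearMap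

theorem bilin_apply (T : PPTav) (x y : T.Λ') : T.bilin x y = T.form x y := rfl

theorem HasMatrix.of_iso {S T : PPTav} {Q : Matrix (Fin 2) (Fin 2) ℝ} (h : Iso S T)
    (hS : S.HasMatrix Q) : T.HasMatrix Q := by
  obtain ⟨g, hg⟩ := isometry_of_iso h
  obtain ⟨b, hb⟩ := hS
  exact ⟨b.map g, fun i j => by simp [hg, hb]⟩

theorem HasMatrix.iso {S T : PPTav} {Q : Matrix (Fin 2) (Fin 2) ℝ} (hS : S.HasMatrix Q)
    (hT : T.HasMatrix Q) : Iso S T := by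
  obtain ⟨b, hb⟩ := hS
  obtain ⟨c, hc⟩ := hT
  let g := b.equiv c (Equiv.refl _)
  have key : T.bilin.compl₁₂ g.toLinearMap g.toLinearMap = S.bilin :=
    b.ext fun i => b.ext fun j => by
      simp [g, bilin_apply, hb, hc]
  refine iso_of_isometry g fun x y => ?_
  exact LinearMap.congr_fun (LinearMap.congr_fun key x) y

theorem form_add_right (T : PPTav) (x y z : T.Λ') :
    T.form x (y + z) = T.form x y + T.form x z := by
  simp [form]

theorem form_sub_left (T : PPTav) (x y z : T.Λ') : T.form (x - y) z = T.form x z - T.form y z := by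
  simp [form]

theorem form_sub_right (T : PPTav) (x y z : T.Λ') :
    T.form x (y - z) = T.form x y - T.form x z := by
  simp [form]

theorem form_smul_right (T : PPTav) (n : ℤ) (x y : T.Λ') : T.form x (n • y) = n * T.form x y := by
  simp [form]

end PPTav

theorem isClassOf_mk_iff {Q : Matrix (Fin 2) (Fin 2) ℝ} {T : {T : PPTav // T.dim = 2}} :
    IsClassOf Q (Quotient.mk pptavSetoid T) ↔ T.1.HasMatrix Q := by
  constructor
  · rintro ⟨S, hS, h⟩
    exact h.of_iso (Quotient.exact (s := pptavSetoid) hS)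
  · exact fun h => ⟨T, rfl, h⟩

theorem mk_mem_torelliFibre {Q : Matrix (Fin 2) (Fin 2) ℝ} {Γ : CurveTwo} :
    Quot.mk Glue Γ ∈ torelliFibre Q ↔ Γ.jac.HasMatrix Q :=
  isClassOf_mk_iff (T := ⟨Γ.jac, Γ.dim_jac⟩)

/-! ### Fibres of the Torelli map -/

/-- The basis `(1, -1, 0)`, `(-1, 0, 1)` of the cycle lattice of the theta graph, as coordinates. -/
def thetaCoord : GenusTwoType.theta.graph.cycles ≃ₗ[ℤ] (Fin 2 → ℤ) where
  toFun c := ![-c.1 1, c.1 2]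
  invFun a := ⟨![a 0 - a 1, -a 0, a 1], (mem_cycles_theta _).2 (by simp; ring)⟩
  map_add' a b := by ext i; fin_cases i <;> simp; ring
  map_smul' n a := by ext i; fin_cases i <;> simp
  left_inv c := by
    have := (mem_cycles_theta _).1 c.2
    ext i
    fin_cases i <;> simp
    linarith
  right_inv a := by ext i; fin_cases i <;> simp

/-- The two basis cycles share only the edge `0` and traverse it in opposite directions, so the
lengths are `-q₁₂`, `-q₁₃`, `-q₂₃` in this order. -/
theorem theta_hasMatrix (l : Fin 3 → ℝ≥0) :
    (CurveTwo.jac ⟨.theta, l⟩).HasMatrix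
      !![(l 0 + l 1 : ℝ), -l 0; -l 0, l 0 + l 2] := by
  refine ⟨Module.Basis.ofEquivFun thetaCoord, fun i j => ?_⟩
  have h := CurveTwo.form_jac ⟨.theta, l⟩
    (Module.Basis.ofEquivFun thetaCoord i) (Module.Basis.ofEquivFun thetaCoord j)
  refine h.trans ?_
  fin_cases i <;> fin_cases j <;> simp [Fin.sum_univ_three, thetaCoord]

/-- The simple cycle of the theta graph that avoids the edge `j`. -/
def thetaCycle (j : Fin 3) : GenusTwoType.theta.graph.cycles :=
  ⟨fun e => if e = j then 0 else if e = j + 1 then 1 else -1,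
    (mem_cycles_theta _).2 (by fin_cases j <;> simp)⟩

/-- Half of a cycle with even coefficients is again a cycle. So an odd coefficient expresses that
the class modulo `2` is nonzero, which an automorphism preserves. -/
theorem exists_odd_of_equiv (g : GenusTwoType.theta.graph.cycles ≃ₗ[ℤ]
    GenusTwoType.theta.graph.cycles) {x : GenusTwoType.theta.graph.cycles}
    (hx : ∃ e, Odd (x.1 e)) : ∃ e, Odd ((g x).1 e) := by
  by_contra! h
  simp only [Int.not_odd_iff_even, even_iff_two_dvd] at h
  choose z hz using h
  have hzc : z ∈ GenusTwoType.theta.graph.cycles := by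
    have := (mem_cycles_theta _).1 (g x).2
    rw [hz, hz, hz] at this
    exact (mem_cycles_theta _).2 (by linarith)
  have h2 : g x = (2 : ℤ) • (⟨z, hzc⟩ : GenusTwoType.theta.graph.cycles) := by
    ext e; simpa using hz e
  have h3 : x = (2 : ℤ) • g.symm ⟨z, hzc⟩ := by
    rw [← map_smul, ← h2, g.symm_apply_apply]
  obtain ⟨e, he⟩ := hx
  rw [h3] at he
  change Odd ((2 : ℤ) * _) at he
  exact (Int.not_odd_iff_even.2 (even_two_mul _)) he

/-- The coefficients of a cycle sum to `0`, so the number of odd ones is even. The position of the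
even one labels the three nonzero classes modulo `2`. -/
theorem exists_parity {x : GenusTwoType.theta.graph.cycles} (hx : ∃ e, Odd (x.1 e)) :
    ∃ i, Even (x.1 i) ∧ ∀ e, e ≠ i → Odd (x.1 e) := by
  have h0 := (mem_cycles_theta _).1 x.2
  have h1 : Even (x.1 0 + x.1 1 + x.1 2) := by rw [h0]; simp
  obtain ⟨e, he⟩ := hx
  rcases Int.even_or_odd (x.1 0) with a | a <;> rcases Int.even_or_odd (x.1 1) with b | b <;>
    rcases Int.even_or_odd (x.1 2) with c | c
  case inl.inr.inr => exact ⟨0, a, by intro e; fin_cases e <;> simp [b, c]⟩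
  case inr.inl.inr => exact ⟨1, b, by intro e; fin_cases e <;> simp [a, c]⟩
  case inr.inr.inl => exact ⟨2, c, by intro e; fin_cases e <;> simp [a, b]⟩
  all_goals exfalso
  · fin_cases e
    · exact (Int.not_odd_iff_even.2 a) he
    · exact (Int.not_odd_iff_even.2 b) he
    · exact (Int.not_odd_iff_even.2 c) he
  · exact Int.not_even_iff_odd.2 ((a.add b).add_odd c) h1
  · exact Int.not_even_iff_odd.2 ((a.add_odd b).add_even c) h1
  · exact Int.not_even_iff_odd.2 ((a.add_even b).add_even c) h1
  · exact Int.not_even_iff_odd.2 ((a.add_odd b).add_odd c) h1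

/-- Odd integers have squares at least `1`. The bound is attained by `thetaCycle i`, so it is the
minimum of the form on the class labelled by `i`. -/
theorem sum_sub_le_form (l : Fin 3 → ℝ≥0) {x : GenusTwoType.theta.graph.cycles} {i : Fin 3}
    (hx : ∀ e, e ≠ i → Odd (x.1 e)) :
    ∑ e, (l e : ℝ) - l i ≤ ∑ e, (l e : ℝ) * (x.1 e : ℝ) * (x.1 e : ℝ) := by
  have h1 : ∑ e, (l e : ℝ) - l i = ∑ e, (if e = i then 0 else (l e : ℝ)) := by
    rw [sub_eq_iff_eq_add, ← Finset.sum_erase_add _ _ (Finset.mem_univ i),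
      ← Finset.sum_erase_add (a := i) (f := fun e => if e = i then 0 else (l e : ℝ)) _
        (Finset.mem_univ i)]
    simp only [if_true, add_zero]
    congr 1
    exact Finset.sum_congr rfl fun e he => by rw [if_neg (Finset.ne_of_mem_erase he)]
  rw [h1]
  refine Finset.sum_le_sum fun e _ => ?_
  split_ifs with h
  · rw [mul_assoc]; exact mul_nonneg (l e).2 (mul_self_nonneg _)
  · have hne : x.1 e ≠ 0 := fun h0 => by simpa [h0] using hx e h
    have h2 : (1 : ℝ) ≤ (x.1 e : ℝ) * (x.1 e : ℝ) := by
      exact_mod_cast Int.add_one_le_iff.2 (mul_self_pos.2 hne)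
    rw [mul_assoc]
    exact le_mul_of_one_le_right (l e).2 h2

theorem form_thetaCycle (l : Fin 3 → ℝ≥0) (j : Fin 3) :
    ∑ e, (l e : ℝ) * ((thetaCycle j).1 e : ℝ) * ((thetaCycle j).1 e : ℝ) = ∑ e, (l e : ℝ) - l j := by
  fin_cases j <;> simp [Fin.sum_univ_three, thetaCycle] <;> ring

/-- An isometry permutes the three nonzero classes modulo `2`. The image of the shortest vector of a
class bounds the minimum of the image class from above. -/
theorem exists_perm_of_isometry {l l' : Fin 3 → ℝ≥0}
    (h : PPTav.Iso (CurveTwo.jac ⟨.theta, l⟩) (CurveTwo.jac ⟨.theta, l'⟩)) :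
    ∃ π : Equiv.Perm (Fin 3), ∀ j, ∑ e, (l' e : ℝ) - l' (π j) ≤ ∑ e, (l e : ℝ) - l j := by
  obtain ⟨g, hg⟩ := PPTav.isometry_of_iso h
  change GenusTwoType.theta.graph.cycles ≃ₗ[ℤ] GenusTwoType.theta.graph.cycles at g
  have hodd : ∀ j, ∃ e, Odd ((thetaCycle j).1 e) := fun j =>
    ⟨j + 1, by fin_cases j <;> simp [thetaCycle]⟩
  choose f hf hf' using fun j => exists_parity (exists_odd_of_equiv g (hodd j))
  have hinj : Function.Injective f := by
    intro i j hij
    by_contra hne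
    -- If two simple cycles had images of the same parity pattern, the image of their difference
    -- would be even everywhere, while the difference itself is odd at the edge `i`.
    obtain ⟨e, he⟩ := exists_odd_of_equiv g (x := thetaCycle i - thetaCycle j)
      ⟨i, by revert hne; fin_cases i <;> fin_cases j <;> simp [thetaCycle]⟩
    rw [map_sub] at he
    change Odd ((g (thetaCycle i)).1 e - (g (thetaCycle j)).1 e) at he
    by_cases hei : e = f i
    · have h1 := hf i
      have h2 := hf j
      rw [← hij, ← hei] at h2
      rw [← hei] at h1
      exact (Int.not_odd_iff_even.2 (h1.sub h2)) he
    · exact (Int.not_odd_iff_even.2 ((hf' i e hei).sub_odd (hf' j e (hij ▸ hei)))) he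
  refine ⟨Equiv.ofBijective f (Finite.injective_iff_bijective.1 hinj), fun j => ?_⟩
  rw [← form_thetaCycle l j]
  exact (sum_sub_le_form l' (hf' j)).trans (hg (thetaCycle j) (thetaCycle j)).le

/-- The lengths of a theta curve can be recovered, up to order, from its Jacobian. -/
theorem eq_comp_perm_of_iso {l l' : Fin 3 → ℝ≥0}
    (h : PPTav.Iso (CurveTwo.jac ⟨.theta, l⟩) (CurveTwo.jac ⟨.theta, l'⟩)) :
    ∃ π : Equiv.Perm (Fin 3), l = l' ∘ π := by
  have key : ∀ {l l' : Fin 3 → ℝ≥0} {π : Equiv.Perm (Fin 3)},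
      (∀ j, ∑ e, (l' e : ℝ) - l' (π j) ≤ ∑ e, (l e : ℝ) - l j) →
      ∑ e, (l' e : ℝ) ≤ ∑ e, (l e : ℝ) := by
    intro l l' π h
    -- Summed over the three edges, the inequalities say that twice the total length of `l'` is at
    -- most twice that of `l`.
    have h1 := Finset.sum_le_sum fun j (_ : j ∈ Finset.univ) => h j
    simp only [Finset.sum_sub_distrib, Finset.sum_const, Finset.card_univ, Fintype.card_fin,
      Equiv.sum_comp π fun e => (l' e : ℝ)] at h1
    simp only [nsmul_eq_mul] at h1
    push_cast at h1
    linarith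
  obtain ⟨π, hπ⟩ := exists_perm_of_isometry h
  obtain ⟨ρ, hρ⟩ := exists_perm_of_isometry (PPTav.iso_equivalence.symm h)
  -- Once the totals agree, each inequality becomes `l j ≤ l' (π j)`; as both sides have the same
  -- sum, all are equalities.
  have hS := le_antisymm (key hπ) (key hρ)
  have h1 : ∀ j ∈ Finset.univ, (l j : ℝ) ≤ l' (π j) := fun j _ => by
    have := hπ j
    linarith
  have h2 := (Finset.sum_eq_sum_iff_of_le h1).1 (by
    rw [Equiv.sum_comp π fun e => (l' e : ℝ)]; exact hS.symm)
  exact ⟨π, funext fun j => by exact_mod_cast h2 j (Finset.mem_univ j)⟩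

theorem thetaCurve_comp_perm (l : Fin 3 → ℝ≥0) (π : Equiv.Perm (Fin 3)) :
    thetaCurve (l ∘ π) = thetaCurve l :=
  (Quot.sound (Glue.thetaAut π l)).symm

theorem thetaCurve_eq_of_hasMatrix {l l' : Fin 3 → ℝ≥0} {Q : Matrix (Fin 2) (Fin 2) ℝ}
    (h : (CurveTwo.jac ⟨.theta, l⟩).HasMatrix Q) (h' : (CurveTwo.jac ⟨.theta, l'⟩).HasMatrix Q) :
    thetaCurve l = thetaCurve l' := by
  obtain ⟨π, rfl⟩ := eq_comp_perm_of_iso (h.iso h')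
  exact thetaCurve_comp_perm l' π

theorem thetaCurve_eq_dumbbellCurve {l : Fin 3 → ℝ≥0} {m : Fin 3} (h : l m = 0) :
    thetaCurve l = dumbbellCurve ![l (m + 1), l (m + 2), 0] := by
  -- The gluing contracts the edge `2` only; the shift by `m + 1` brings the edge `m` there, since
  -- `2 + (m + 1) = m` in `Fin 3`.
  rw [← thetaCurve_comp_perm l (Equiv.addRight (m + 1))]
  have : l ∘ Equiv.addRight (m + 1) = ![l (m + 1), l (m + 2), 0] := by
    ext i
    fin_cases m <;> fin_cases i <;> simp_all
  rw [this]
  exact Quot.sound (Glue.contract _ (by simp))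

/-- The bridge does not contribute to the Jacobian. -/
theorem iso_dumbbell (l l' : Fin 3 → ℝ≥0) (h0 : l' 0 = l 0) (h1 : l' 1 = l 1) :
    PPTav.Iso (CurveTwo.jac ⟨.dumbbell, l⟩) (CurveTwo.jac ⟨.dumbbell, l'⟩) := by
  refine PPTav.iso_of_isometry (LinearEquiv.refl ℤ GenusTwoType.dumbbell.graph.cycles)
    fun x y => ?_
  have hx := (mem_cycles_dumbbell _).1 x.2
  change ∑ e, (l' e : ℝ) * (x.1 e : ℝ) * (y.1 e : ℝ) = ∑ e, (l e : ℝ) * (x.1 e : ℝ) * (y.1 e : ℝ)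
  simp [Fin.sum_univ_three, h0, h1, hx]

/-- This reduces every question about dumbbell Jacobians to the uniqueness of theta lengths. -/
theorem iso_theta_dumbbell (l : Fin 3 → ℝ≥0) :
    PPTav.Iso (CurveTwo.jac ⟨.theta, ![l 0, l 1, 0]⟩) (CurveTwo.jac ⟨.dumbbell, l⟩) :=
  PPTav.iso_equivalence.trans (Glue.contract ![l 0, l 1, 0] (by simp)).iso_jac
    (iso_dumbbell _ _ (by simp) (by simp))

/-- A dumbbell in the fibre would force one of the three lengths to be `0`. -/
theorem torelliFibre_of_pos {l : Fin 3 → ℝ≥0} {Q : Matrix (Fin 2) (Fin 2) ℝ}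
    (h : (CurveTwo.jac ⟨.theta, l⟩).HasMatrix Q) (hl : ∀ i, 0 < l i) :
    torelliFibre Q = {thetaCurve l} := by
  refine Set.eq_singleton_iff_unique_mem.2 ⟨mk_mem_torelliFibre.2 h, ?_⟩
  rintro ⟨t, l'⟩ hm
  replace hm := mk_mem_torelliFibre.1 hm
  cases t
  · exact thetaCurve_eq_of_hasMatrix hm h
  · obtain ⟨π, hπ⟩ := eq_comp_perm_of_iso
      (PPTav.iso_equivalence.trans (iso_theta_dumbbell l') (hm.iso h))
    have := congrFun hπ 2
    exact absurd this (by simpa using (hl (π 2)).ne)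

theorem dumbbellCurve_swap (a b t : ℝ≥0) : dumbbellCurve ![a, b, t] = dumbbellCurve ![b, a, t] := by
  refine (Quot.sound (Glue.dumbbellAut _)).trans (congrArg dumbbellCurve ?_)
  have h2 : Equiv.swap (0 : Fin 3) 1 2 = 2 := by decide
  ext i; fin_cases i
  · simp
  · simp
  · simp [h2]

theorem eq_or_eq_of_perm {a b a' b' : ℝ≥0} (ha : 0 < a) (hb : 0 < b) {π : Equiv.Perm (Fin 3)}
    (h : ![a, b, 0] = ![a', b', 0] ∘ π) : (a = a' ∧ b = b') ∨ (a = b' ∧ b = a') := by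
  have e0 := congrFun h 0
  have e1 := congrFun h 1
  have n01 : π 0 ≠ π 1 := π.injective.ne (by decide)
  simp only [Function.comp_apply, Matrix.cons_val_zero, Matrix.cons_val_one] at e0 e1
  generalize π 0 = i at *
  generalize π 1 = j at *
  fin_cases i <;> fin_cases j <;> simp_all

/-- By the uniqueness of theta lengths the Jacobian determines the two loops up to order, and it
says nothing about the bridge. -/
theorem torelliFibre_of_eq_zero {l : Fin 3 → ℝ≥0} {Q : Matrix (Fin 2) (Fin 2) ℝ}
    (h : (CurveTwo.jac ⟨.theta, l⟩).HasMatrix Q) {m : Fin 3} (hm : l m = 0)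
    (h1 : 0 < l (m + 1)) (h2 : 0 < l (m + 2)) :
    torelliFibre Q = Set.range fun t : ℝ≥0 => dumbbellCurve ![l (m + 1), l (m + 2), t] := by
  have hd : ∀ t, (CurveTwo.jac ⟨.dumbbell, ![l (m + 1), l (m + 2), t]⟩).HasMatrix Q := fun t => by
    have := mk_mem_torelliFibre.2 h
    change thetaCurve l ∈ _ at this
    rw [thetaCurve_eq_dumbbellCurve hm] at this
    exact (mk_mem_torelliFibre.1 this).of_iso (iso_dumbbell _ _ (by simp) (by simp))
  refine Set.Subset.antisymm ?_ ?_
  · rintro ⟨t, l'⟩ hm'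
    have hm' := mk_mem_torelliFibre.1 hm'
    cases t
    · exact ⟨0, (thetaCurve_eq_dumbbellCurve hm).symm.trans (thetaCurve_eq_of_hasMatrix h hm')⟩
    · refine ⟨l' 2, ?_⟩
      obtain ⟨π, hπ⟩ := eq_comp_perm_of_iso
        (PPTav.iso_equivalence.trans (iso_theta_dumbbell ![l (m + 1), l (m + 2), 0])
          ((hd 0).iso (hm'.of_iso (PPTav.iso_equivalence.symm (iso_theta_dumbbell l')))))
      have hl' : (⟨.dumbbell, l'⟩ : CurveTwo) = ⟨.dumbbell, ![l' 0, l' 1, l' 2]⟩ := by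
        congr 1; ext i; fin_cases i <;> rfl
      rw [hl']
      change dumbbellCurve _ = dumbbellCurve _
      rcases eq_or_eq_of_perm h1 h2 hπ with ⟨ha, hb⟩ | ⟨ha, hb⟩
      · rw [ha, hb]
      · rw [ha, hb]
        exact dumbbellCurve_swap _ _ _
  · rintro _ ⟨t, rfl⟩
    exact mk_mem_torelliFibre.2 (hd t)

/-! ### Split Jacobians and the matrices `Qpp d k x` -/

namespace PPTav

/-- The map `x ↦ [x, y] / d` on `Λ`. It represents a `d`-torsion point. -/
noncomputable def frac (T : PPTav) (d : ℕ) : T.Λ' →ₗ[ℤ] T.Λ →ₗ[ℤ] ℝ :=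
  ((d : ℝ)⁻¹ • LinearMap.id : ℝ →ₗ[ℝ] ℝ).restrictScalars ℤ |>.compRight ℤ |>.comp T.pairing.flip

theorem frac_apply (T : PPTav) (d : ℕ) (y : T.Λ') (x : T.Λ) :
    T.frac d y x = (d : ℝ)⁻¹ * T.pairing x y := rfl

theorem smul_frac (T : PPTav) {d : ℕ} (hd : d ≠ 0) (y : T.Λ') :
    (d : ℤ) • T.frac d y = T.pairing.flip y := by
  ext x
  have : (d : ℝ) ≠ 0 := by exact_mod_cast hd
  simp [frac_apply, this]

/-- The polarization of the source of an isogeny, restricted to the lattice of the target. -/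
noncomputable def Hom.dual {S T : PPTav} (f : Hom S T) : T.Λ' →ₗ[ℤ] S.Λ' :=
  S.ζ.symm.toLinearMap ∘ₗ f.sharp ∘ₗ T.ζ.toLinearMap

section Isogeny

variable {S T : PPTav} {f : Hom S T} {d : ℕ}

theorem Hom.dual_injective (hf : f.IsIsogeny) : Function.Injective f.dual :=
  S.ζ.symm.injective.comp (hf.1.comp T.ζ.injective)

theorem Hom.dual_flat (hp : ∀ x, f.sharp (T.ζ (f.flat x)) = (d : ℤ) • S.ζ x) (x : S.Λ') :
    f.dual (f.flat x) = (d : ℤ) • x := by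
  simp [Hom.dual, hp]

/-- The composite in the other order is `d` by the condition on polarizations; the injective map
`f.dual` can be cancelled. -/
theorem Hom.flat_dual (hf : f.IsIsogeny)
    (hp : ∀ x, f.sharp (T.ζ (f.flat x)) = (d : ℤ) • S.ζ x) (y : T.Λ') :
    f.flat (f.dual y) = (d : ℤ) • y := by
  apply Hom.dual_injective hf
  rw [Hom.dual_flat hp, map_smul]

theorem Hom.form_flat (f : Hom S T) (y : T.Λ') (x : S.Λ') :
    T.form y (f.flat x) = S.form (f.dual y) x := by
  simp only [form, ← f.compat, Hom.dual, LinearMap.comp_apply, LinearEquiv.coe_coe,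
    LinearEquiv.apply_symm_apply]

/-- Through `f.dual`, the lattice of the target becomes a sublattice of that of the source, with the
form divided by `d`. -/
theorem Hom.form_dual (hf : f.IsIsogeny)
    (hp : ∀ x, f.sharp (T.ζ (f.flat x)) = (d : ℤ) • S.ζ x) (y z : T.Λ') :
    d * T.form y z = S.form (f.dual y) (f.dual z) := by
  rw [← f.form_flat, Hom.flat_dual hf hp, form_smul_right]
  simp

/-- The class of `ϕ` is killed iff `ϕ ∘ f.sharp` is the pairing with some `y`. Since `f.sharp` hits
every multiple of `d`, this determines `ϕ` as `f.dual y` divided by `d`. So the kernel and the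
sublattice `f.dual (Λ')` carry the same information. -/
theorem Hom.mk_mem_ker_onPoints_iff (hd : d ≠ 0) (hf : f.IsIsogeny)
    (hp : ∀ x, f.sharp (T.ζ (f.flat x)) = (d : ℤ) • S.ζ x) {ϕ : S.Λ →ₗ[ℤ] ℝ} :
    (Submodule.Quotient.mk ϕ : S.Points) ∈ LinearMap.ker f.onPoints ↔
      ∃ y, ϕ = S.frac d (f.dual y) := by
  have hd' : (d : ℝ) ≠ 0 := by exact_mod_cast hd
  rw [LinearMap.mem_ker, Hom.onPoints, Submodule.mapQ_apply, Submodule.Quotient.mk_eq_zero,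
    LinearMap.mem_range]
  refine exists_congr fun y => ⟨fun h => ?_, fun h => ?_⟩
  · ext x
    -- This argument is chosen because `f.sharp` maps it to `d • x`.
    have h1 := LinearMap.congr_fun h (T.ζ (f.flat (S.ζ.symm x)))
    change T.pairing _ y = ϕ (f.sharp _) at h1
    rw [hp, S.ζ.apply_symm_apply, map_smul, T.symm] at h1
    change T.form y _ = _ at h1
    rw [f.form_flat, form, S.symm, S.ζ.apply_symm_apply] at h1
    rw [frac_apply, h1]
    simp [hd']
  · ext x
    change T.pairing x y = ϕ (f.sharp x)
    rw [h, frac_apply, f.compat, Hom.flat_dual hf hp]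
    simp [hd']

end Isogeny

/-- The torsion point `y / d`. -/
noncomputable def divPoint (T : PPTav) (d : ℕ) : T.Λ' →ₗ[ℤ] T.Points :=
  Submodule.mkQ _ ∘ₗ T.frac d

theorem divPoint_mem (T : PPTav) {d : ℕ} (hd : d ≠ 0) (y : T.Λ') :
    T.divPoint d y ∈ Submodule.torsionBy ℤ T.Points (d : ℤ) := by
  rw [Submodule.mem_torsionBy_iff, divPoint, LinearMap.comp_apply, ← map_smul, smul_frac _ hd]
  exact (Submodule.Quotient.mk_eq_zero _).2 ⟨y, rfl⟩

theorem inl_divPoint_add_inr_divPoint (S T : PPTav) (d : ℕ) (x : S.Λ') (y : T.Λ') :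
    (inl S T).onPoints (S.divPoint d x) + (inr S T).onPoints (T.divPoint d y) =
      (prod S T).divPoint d (x, y) := by
  change Submodule.Quotient.mk (_ + _) = Submodule.Quotient.mk _
  congr 1
  refine LinearMap.ext fun z => ?_
  change S.frac d x z.1 + T.frac d y z.2 = (d : ℝ)⁻¹ * (S.pairing z.1 x + T.pairing z.2 y)
  rw [frac_apply, frac_apply, mul_add]

/-- The pairing has trivial kernel in `Λ'`. -/
def IsNondegenerate (T : PPTav) : Prop := Function.Injective T.pairing.flip

theorem frac_injective {T : PPTav} (hT : T.IsNondegenerate) {d : ℕ} (hd : d ≠ 0) :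
    Function.Injective (T.frac d) := fun x y h => by
  apply hT
  rw [← smul_frac _ hd, ← smul_frac _ hd, h]

theorem divPoint_eq_iff {T : PPTav} (hT : T.IsNondegenerate) {d : ℕ} (hd : d ≠ 0) {x y : T.Λ'} :
    T.divPoint d x = T.divPoint d y ↔ ∃ z, x - y = (d : ℤ) • z := by
  rw [← sub_eq_zero, ← map_sub]
  refine (Submodule.Quotient.mk_eq_zero _).trans (exists_congr fun z => ?_)
  have hd' : (d : ℤ) ≠ 0 := by exact_mod_cast hd
  constructor
  · intro h
    apply hT
    rw [map_smul, h, smul_frac _ hd]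
  · intro h
    apply smul_right_injective _ hd'
    change (d : ℤ) • _ = (d : ℤ) • _
    rw [smul_frac _ hd, h, map_smul]

theorem elliptic_isNondegenerate (l : ℝ) (hl : 0 < l) : (elliptic l hl).IsNondegenerate := by
  intro (x : ℤ) (y : ℤ) h
  have h1 := LinearMap.congr_fun h (1 : ℤ)
  change l * ((1 : ℤ) : ℝ) * (x : ℝ) = l * ((1 : ℤ) : ℝ) * (y : ℝ) at h1
  simp only [Int.cast_one, mul_one] at h1
  exact_mod_cast mul_left_cancel₀ hl.ne' h1

theorem prod_isNondegenerate {S T : PPTav} (hS : S.IsNondegenerate) (hT : T.IsNondegenerate) :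
    (prod S T).IsNondegenerate := by
  intro x y h
  refine Prod.ext (hS (LinearMap.ext fun z => ?_)) (hT (LinearMap.ext fun z => ?_))
  · have := LinearMap.congr_fun h (z, (0 : T.Λ))
    change S.pairing z x.1 + T.pairing 0 x.2 = S.pairing z y.1 + T.pairing 0 y.2 at this
    simpa using this
  · have := LinearMap.congr_fun h ((0 : S.Λ), z)
    change S.pairing 0 x.1 + T.pairing z x.2 = S.pairing 0 y.1 + T.pairing z y.2 at this
    simpa using this

/-- The `d`-torsion of a tropical elliptic curve. -/
theorem exists_torsionEquiv (l : ℝ) (hl : 0 < l) {d : ℕ} (hd : d ≠ 0) :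
    ∃ e : ZMod d ≃+ (elliptic l hl).Torsion d,
      ∀ n : ℤ, (e n : (elliptic l hl).Points) = (elliptic l hl).divPoint d (n : ℤ) := by
  let h : ℤ →+ (elliptic l hl).Torsion d :=
    (((elliptic l hl).divPoint d).codRestrict _ (divPoint_mem _ hd)).toAddMonoidHom
  have hh : ∀ n : ℤ, (h n : (elliptic l hl).Points) = (elliptic l hl).divPoint d (n : ℤ) :=
    fun n => rfl
  have hker : ∀ n : ℤ, h n = 0 ↔ (d : ℤ) ∣ n := fun n => by
    rw [← Subtype.coe_inj, hh]
    have := divPoint_eq_iff (elliptic_isNondegenerate l hl) hd (x := (n : ℤ)) (y := (0 : ℤ))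
    rw [show (elliptic l hl).divPoint d (0 : ℤ) = 0 from map_zero _] at this
    refine this.trans (exists_congr fun (z : ℤ) => ?_)
    change n - 0 = (d : ℤ) * z ↔ n = (d : ℤ) * z
    rw [sub_zero]
  let e := ZMod.lift d ⟨h, (hker d).2 dvd_rfl⟩
  have he : ∀ n : ℤ, e n = h n := fun n => ZMod.lift_coe d ⟨h, (hker d).2 dvd_rfl⟩ n
  refine ⟨AddEquiv.ofBijective e ⟨?_, ?_⟩, fun n => ?_⟩
  · refine (injective_iff_map_eq_zero e).2 fun a ha => ?_
    obtain ⟨n, rfl⟩ := ZMod.intCast_surjective a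
    rw [he, hker] at ha
    exact (ZMod.intCast_zmod_eq_zero_iff_dvd n d).2 ha
  -- If `P` is represented by `ϕ` and is `d`-torsion, then `d • ϕ` is the pairing with an integer
  -- `n`, so `ϕ` is `n / d`.
  · rintro ⟨P, hP⟩
    obtain ⟨ϕ, rfl⟩ := Submodule.Quotient.mk_surjective _ P
    rw [Submodule.mem_torsionBy_iff, ← Submodule.Quotient.mk_smul,
      Submodule.Quotient.mk_eq_zero] at hP
    obtain ⟨n, hn⟩ := hP
    refine ⟨Int.cast n, Subtype.ext ?_⟩
    refine ((congrArg Subtype.val (he n)).trans (hh n)).trans ?_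
    change Submodule.Quotient.mk _ = Submodule.Quotient.mk _
    congr 1
    have hd' : (d : ℤ) ≠ 0 := by exact_mod_cast hd
    apply smul_right_injective _ hd'
    change (d : ℤ) • _ = (d : ℤ) • _
    rw [← hn, smul_frac _ hd]
  · exact (congrArg Subtype.val (he n)).trans (hh n)

theorem addAut_zmod_eq_mulLeft {d : ℕ} (a : ZMod d ≃+ ZMod d) :
    ∃ u : (ZMod d)ˣ, ∀ x, a x = u * x := by
  have h : ∀ (b : ZMod d ≃+ ZMod d) (x : ZMod d), b x = b 1 * x := fun b x => by
    obtain ⟨n, rfl⟩ := ZMod.intCast_surjective x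
    have := map_zsmul b n (1 : ZMod d)
    simpa [mul_comm] using this
  have h1 : a 1 * a.symm 1 = 1 := by rw [← h a, a.apply_symm_apply]
  exact ⟨⟨a 1, a.symm 1, h1, by rw [mul_comm, h1]⟩, h a⟩

/-- Torsion points are written as integers divided by `d`, so the graph of `α` becomes a congruence
on pairs of integers. -/
theorem mem_graph_iff {l' l : ℝ} (hl' : 0 < l') (hl : 0 < l) {d : ℕ}
    {e' : ZMod d ≃+ (elliptic l' hl').Torsion d}
    (he' : ∀ n : ℤ, (e' n : (elliptic l' hl').Points) = (elliptic l' hl').divPoint d (n : ℤ))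
    {e : ZMod d ≃+ (elliptic l hl).Torsion d}
    (he : ∀ n : ℤ, (e n : (elliptic l hl).Points) = (elliptic l hl).divPoint d (n : ℤ))
    {α : (elliptic l' hl').Torsion d ≃+ (elliptic l hl).Torsion d} {u : (ZMod d)ˣ}
    (hu : ∀ x, α (e' x) = e (u * x)) (P : (prod (elliptic l' hl') (elliptic l hl)).Points) :
    (P ∈ Set.range fun P : (elliptic l' hl').Torsion d =>
        (inl (elliptic l' hl') (elliptic l hl)).onPoints P +
          (inr (elliptic l' hl') (elliptic l hl)).onPoints (α P)) ↔
      ∃ z : ℤ × ℤ, (u * z.1 : ZMod d) = z.2 ∧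
        P = (prod (elliptic l' hl') (elliptic l hl)).divPoint d z := by
  have key : ∀ m n : ℤ, (u * m : ZMod d) = n →
      (inl (elliptic l' hl') (elliptic l hl)).onPoints (e' m) +
          (inr (elliptic l' hl') (elliptic l hl)).onPoints (α (e' m)) =
      (prod (elliptic l' hl') (elliptic l hl)).divPoint d ((m, n) : ℤ × ℤ) := fun m n h => by
    rw [hu, h, he, he']
    exact inl_divPoint_add_inr_divPoint (elliptic l' hl') (elliptic l hl) d (m : ℤ) (n : ℤ)
  constructor
  · rintro ⟨A, rfl⟩
    obtain ⟨m, rfl⟩ := e'.surjective A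
    obtain ⟨m, rfl⟩ := ZMod.intCast_surjective m
    obtain ⟨n, hn⟩ := ZMod.intCast_surjective (u * m : ZMod d)
    exact ⟨(m, n), hn.symm, key m n hn.symm⟩
  · rintro ⟨⟨m, n⟩, h, rfl⟩
    exact ⟨e' m, key m n h⟩

/-- The slope `-k⁻¹` is the one whose graph is the lattice containing `(-k, 1)`, the second basis
vector behind `Qpp`. -/
theorem eq_iff_add_mul_eq_zero {d : ℕ} (k : (ZMod d)ˣ) (a b : ZMod d) :
    ((-k⁻¹ : (ZMod d)ˣ) : ZMod d) * a = b ↔ a + k * b = 0 := by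
  constructor
  · rintro rfl
    simp
  · intro h
    rw [eq_neg_of_add_eq_zero_left h]
    simp

/-- The kernel identifies the image of `f.dual` with `{(a, b) : a + k b ≡ 0 mod d}`; the preimages
of `(d, 0)` and `(-k, 1)` form the required basis. -/
theorem IsDSplit.hasMatrix {d : ℕ} (hd : d ≠ 0) {T : PPTav} (h : T.IsDSplit d) :
    ∃ k : (ZMod d)ˣ, ∃ x ∈ openQuadrant, T.HasMatrix (Qpp d k x) := by
  have : NeZero d := ⟨hd⟩
  have hd' : (d : ℝ) ≠ 0 := by exact_mod_cast hd
  obtain ⟨l', l, hl', hl, f, α, hf, hp, hker⟩ := h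
  obtain ⟨e', he'⟩ := exists_torsionEquiv l' hl' hd
  obtain ⟨e, he⟩ := exists_torsionEquiv l hl hd
  obtain ⟨u, hu⟩ := addAut_zmod_eq_mulLeft ((e'.trans α).trans e.symm)
  replace hu : ∀ x, α (e' x) = e (u * x) := fun x => by
    rw [← hu]; simp
  obtain ⟨k, rfl⟩ : ∃ k : (ZMod d)ˣ, u = -k⁻¹ := ⟨-u⁻¹, by simp⟩
  refine ⟨k, (l', l), ⟨hl', hl⟩, ?_⟩
  let g : T.Λ' →ₗ[ℤ] ℤ × ℤ := f.dual
  have hg : Function.Injective g := Hom.dual_injective hf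
  have hform : ∀ y z, d * T.form y z = l' * (g y).1 * (g z).1 + l * (g y).2 * (g z).2 :=
    fun y z => Hom.form_dual hf hp y z
  have hrange : ∀ z : ℤ × ℤ, (z.1 + k * z.2 : ZMod d) = 0 ↔ ∃ y, g y = z := by
    intro z
    have h1 := mem_graph_iff hl' hl he' he hu
      ((prod (elliptic l' hl') (elliptic l hl)).divPoint d z)
    rw [← hker] at h1
    have h2 := h1.symm.trans (Hom.mk_mem_ker_onPoints_iff hd hf hp)
    constructor
    · intro hz
      obtain ⟨y, hy⟩ := h2.1 ⟨z, (eq_iff_add_mul_eq_zero k _ _).2 hz, rfl⟩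
      exact ⟨y, frac_injective (prod_isNondegenerate (elliptic_isNondegenerate l' hl')
        (elliptic_isNondegenerate l hl)) hd hy.symm⟩
    · rintro ⟨y, rfl⟩
      obtain ⟨w, hw, hwy⟩ := h2.2 ⟨y, rfl⟩
      -- A point determines its numerator only modulo `d`, which is enough because the congruence is
      -- one modulo `d`.
      obtain ⟨c, hc⟩ : ∃ c : ℤ × ℤ, g y - w = (d : ℤ) • c :=
        (divPoint_eq_iff (prod_isNondegenerate (elliptic_isNondegenerate l' hl')
          (elliptic_isNondegenerate l hl)) hd).1 hwy
      rw [eq_add_of_sub_eq hc]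
      simpa using (eq_iff_add_mul_eq_zero k _ _).1 hw
  obtain ⟨y₁, hy₁⟩ := (hrange (d, 0)).1 (by simp)
  obtain ⟨y₂, hy₂⟩ := (hrange (-((k : ZMod d).val : ℤ), 1)).1 (by simp)
  have hli : LinearIndependent ℤ ![y₁, y₂] := by
    refine LinearIndependent.pair_iff.2 fun s t hst => ?_
    have := congrArg g hst
    simp only [map_add, map_smul, hy₁, hy₂, map_zero, Prod.ext_iff, Prod.fst_add, Prod.smul_fst,
      Prod.snd_add, Prod.smul_snd, smul_eq_mul, mul_zero, mul_one, zero_add, Prod.fst_zero,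
      Prod.snd_zero] at this
    obtain ⟨h1, rfl⟩ := this
    simp [hd] at h1
    exact ⟨h1, rfl⟩
  have hsp : ⊤ ≤ Submodule.span ℤ (Set.range ![y₁, y₂]) := by
    intro y _
    have h1 := (hrange (g y)).2 ⟨y, rfl⟩
    obtain ⟨n, hn⟩ : (d : ℤ) ∣ (g y).1 + (k : ZMod d).val * (g y).2 := by
      rw [← ZMod.intCast_zmod_eq_zero_iff_dvd]
      simpa using h1
    have h2 : y = n • y₁ + (g y).2 • y₂ := by
      apply hg
      rw [map_add, map_smul, map_smul, hy₁, hy₂]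
      refine Prod.ext ?_ ?_
      · simp only [Prod.fst_add, Prod.smul_fst, smul_eq_mul]; linarith
      · simp
    rw [h2]
    exact add_mem (Submodule.smul_mem _ _ (Submodule.subset_span ⟨0, rfl⟩))
      (Submodule.smul_mem _ _ (Submodule.subset_span ⟨1, rfl⟩))
  refine ⟨Module.Basis.mk hli hsp, fun i j => ?_⟩
  have h1 := hform (![y₁, y₂] i) (![y₁, y₂] j)
  rw [Module.Basis.coe_mk]
  apply mul_left_cancel₀ hd'
  rw [h1]
  fin_cases i <;> fin_cases j <;> simp [hy₁, hy₂, Qpp] <;> field_simp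

/-- Here `g` embeds the lattice by sending the given basis to `(d, 0)`, `(-c, 1)`, and the isogeny
has `g`, transported by the polarization, as `sharp` and `d • g⁻¹` as `flat`. -/
theorem HasMatrix.isDSplit {d : ℕ} (hd : d ≠ 0) {T : PPTav} {k : (ZMod d)ˣ} {x : ℝ × ℝ}
    (hx : x ∈ openQuadrant) (h : T.HasMatrix (Qpp d k x)) : T.IsDSplit d := by
  have : NeZero d := ⟨hd⟩
  have hd' : (d : ℝ) ≠ 0 := by exact_mod_cast hd
  have hdz : (d : ℤ) ≠ 0 := by exact_mod_cast hd
  obtain ⟨l', l⟩ := x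
  obtain ⟨hl', hl⟩ := hx
  change 0 < l' at hl'
  change 0 < l at hl
  obtain ⟨b, hb⟩ := h
  set c : ℤ := ((k : ZMod d).val : ℤ) with hc
  let g : T.Λ' →ₗ[ℤ] ℤ × ℤ := b.constr ℤ ![((d : ℤ), (0 : ℤ)), (-c, 1)]
  have g0 : g (b 0) = ((d : ℤ), 0) := by simp [g]
  have g1 : g (b 1) = (-c, 1) := by simp [g]
  -- This is `d • g⁻¹`: one has `d (a, b) = (a + c b) (d, 0) + d b (-c, 1)`.
  let fl : ℤ × ℤ →ₗ[ℤ] T.Λ' :=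
    (LinearMap.fst ℤ ℤ ℤ + c • LinearMap.snd ℤ ℤ ℤ).smulRight (b 0) +
      ((d : ℤ) • LinearMap.snd ℤ ℤ ℤ).smulRight (b 1)
  have hfl : ∀ z, fl z = (z.1 + c * z.2) • b 0 + (d * z.2) • b 1 := fun z => rfl
  have hgfl : ∀ z, g (fl z) = (d : ℤ) • z := fun z => by
    rw [hfl, map_add, map_smul, map_smul, g0, g1]
    refine Prod.ext ?_ ?_
    · simp only [Prod.fst_add, Prod.smul_fst, smul_eq_mul]; ring
    · simp
  have hflg : ∀ y, fl (g y) = (d : ℤ) • y := by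
    have : fl ∘ₗ g = (d : ℤ) • LinearMap.id := b.ext fun i => by
      fin_cases i
      · simp [g0, hfl]
      · simp [g1, hfl]
    exact fun y => LinearMap.congr_fun this y
  have hform : ∀ y z, l' * (g y).1 * z.1 + l * (g y).2 * z.2 = T.form y (fl z) := by
    intro y z
    have key : ((prod (elliptic l' hl') (elliptic l hl)).bilin.flip z ∘ₗ g) =
        T.bilin.flip (fl z) := by
      refine b.ext fun i => ?_
      change l' * ((g (b i)).1 : ℝ) * z.1 + l * ((g (b i)).2 : ℝ) * z.2 = T.form (b i) (fl z)
      rw [hfl, form_add_right, form_smul_right, form_smul_right, hb, hb]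
      fin_cases i
      · simp [g0, Qpp, hc]
        ring
      · simp [g1, Qpp, hc]
        field_simp
        ring
    exact LinearMap.congr_fun key y
  have ginj : Function.Injective g := fun y z h => by
    have h1 := hflg y
    rw [h, hflg] at h1
    exact (smul_right_injective _ hdz h1).symm
  have flinj : Function.Injective fl := fun y z h => by
    have h1 := hgfl y
    rw [h, hgfl] at h1
    exact (smul_right_injective _ hdz h1).symm
  have hrange : ∀ z : ℤ × ℤ, (z.1 + k * z.2 : ZMod d) = 0 ↔ ∃ y, g y = z := by
    intro z
    have h1 : (z.1 + k * z.2 : ZMod d) = ((z.1 + c * z.2 : ℤ) : ZMod d) := by simp [hc]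
    rw [h1, ZMod.intCast_zmod_eq_zero_iff_dvd]
    constructor
    · rintro ⟨n, hn⟩
      refine ⟨n • b 0 + z.2 • b 1, ?_⟩
      rw [map_add, map_smul, map_smul, g0, g1]
      refine Prod.ext ?_ ?_
      · simp only [Prod.fst_add, Prod.smul_fst, smul_eq_mul]; linarith
      · simp
    · rintro ⟨y, rfl⟩
      have h2 := hflg y
      rw [hfl] at h2
      -- The coefficient of `b 0` in `fl (g y) = d • y` exhibits the divisibility by `d`.
      have h3 := congrArg (fun v => b.repr v 0) h2
      simp at h3
      exact ⟨_, h3⟩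
  let f : Hom (prod (elliptic l' hl') (elliptic l hl)) T :=
    { sharp := g ∘ₗ T.ζ.symm.toLinearMap
      flat := fl
      compat := fun x y => by
        refine (hform (T.ζ.symm x) y).trans ?_
        rw [form, T.ζ.apply_symm_apply]
        rfl }
  have hp : ∀ x, f.sharp (T.ζ (f.flat x)) =
      (d : ℤ) • (prod (elliptic l' hl') (elliptic l hl)).ζ x := fun x => by
    change g (T.ζ.symm (T.ζ (fl x))) = _
    rw [T.ζ.symm_apply_apply]
    exact hgfl x
  have hf : f.IsIsogeny := ⟨ginj.comp T.ζ.symm.injective, flinj⟩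
  have hdual : ∀ y, f.dual y = g y := fun y => by
    change g (T.ζ.symm (T.ζ y)) = _
    rw [T.ζ.symm_apply_apply]
  obtain ⟨e', he'⟩ := exists_torsionEquiv l' hl' hd
  obtain ⟨e, he⟩ := exists_torsionEquiv l hl hd
  let α := (e'.symm.trans (AddAut.mulLeft (-k⁻¹))).trans e
  refine ⟨l', l, hl', hl, f, α, hf, hp, Set.ext fun P => ?_⟩
  rw [mem_graph_iff hl' hl he' he (u := -k⁻¹) (fun x => by
    change e (_ * e'.symm (e' x)) = _
    rw [e'.symm_apply_apply])]
  obtain ⟨ϕ, rfl⟩ := Submodule.Quotient.mk_surjective _ P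
  refine (Hom.mk_mem_ker_onPoints_iff hd hf hp).trans ⟨?_, ?_⟩
  · rintro ⟨y, rfl⟩
    exact ⟨g y, (eq_iff_add_mul_eq_zero k _ _).2 ((hrange _).2 ⟨y, rfl⟩), by rw [hdual]; rfl⟩
  · rintro ⟨z, hz, hP⟩
    obtain ⟨y, rfl⟩ := (hrange z).1 ((eq_iff_add_mul_eq_zero k _ _).1 hz)
    refine (Hom.mk_mem_ker_onPoints_iff hd hf hp).1 ?_
    rw [hP]
    exact (Hom.mk_mem_ker_onPoints_iff hd hf hp).2 ⟨y, by rw [hdual]⟩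

end PPTav

theorem splitLocus_eq {d : ℕ} (hd : d ≠ 0) : splitLocus d = ⋃ k : (ZMod d)ˣ, splitPiece d k := by
  ext m
  simp only [Set.mem_iUnion]
  constructor
  · rintro ⟨T, hT, h⟩
    obtain ⟨k, x, hx, hm⟩ := h.hasMatrix hd
    exact ⟨k, x, hx, T, hT, hm⟩
  · rintro ⟨k, x, hx, T, hT, hm⟩
    exact ⟨T, hT, hm.isDSplit hd hx⟩

/-! ### Fans in the quadrant given by a sequence of rays -/

/-- A sequence of integral vectors in the closed quadrant that runs
clockwise from the second axis to the first axis. -/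
structure IsRaySequence (N : ℕ) (v : ℕ → ℤ × ℤ) : Prop where
  fst_zero : (v 0).1 = 0
  snd_last : (v (N + 1)).2 = 0
  fst_pos : ∀ i, 1 ≤ i → i ≤ N + 1 → 0 < (v i).1
  snd_pos : ∀ i ≤ N, 0 < (v i).2
  cross : ∀ i ≤ N, (v i).1 * (v (i + 1)).2 < (v (i + 1)).1 * (v i).2

/-- The linear form `v × ·`. -/
noncomputable def crossForm (v : ℤ × ℤ) : ℝ × ℝ →ₗ[ℝ] ℝ :=
  (v.1 : ℝ) • LinearMap.snd ℝ ℝ ℝ - (v.2 : ℝ) • LinearMap.fst ℝ ℝ ℝ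

theorem crossForm_apply (v : ℤ × ℤ) (x : ℝ × ℝ) : crossForm v x = v.1 * x.2 - v.2 * x.1 := rfl

theorem continuous_crossForm (v : ℤ × ℤ) : Continuous (crossForm v) :=
  (crossForm v).continuous_of_finiteDimensional

/-- An integral vector as a real vector. -/
def realVec (v : ℤ × ℤ) : ℝ × ℝ := (v.1, v.2)

/-- The sector between the `i`-th and the `j`-th ray. -/
def sector (v : ℕ → ℤ × ℤ) (i j : ℕ) : Set (ℝ × ℝ) :=
  {x ∈ closedQuadrant | crossForm (v i) x ≤ 0 ∧ 0 ≤ crossForm (v j) x}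

/-- The open sector between two consecutive rays. -/
def openSector (v : ℕ → ℤ × ℤ) (i : ℕ) : Set (ℝ × ℝ) :=
  {x ∈ openQuadrant | crossForm (v i) x < 0 ∧ 0 < crossForm (v (i + 1)) x}

theorem openQuadrant_subset : openQuadrant ⊆ closedQuadrant := fun _ h => ⟨h.1.le, h.2.le⟩

theorem openSector_subset_sector (v : ℕ → ℤ × ℤ) (i : ℕ) : openSector v i ⊆ sector v i (i + 1) :=
  fun _ h => ⟨openQuadrant_subset h.1, h.2.1.le, h.2.2.le⟩

theorem isClosed_sector (v : ℕ → ℤ × ℤ) (i j : ℕ) : IsClosed (sector v i j) := by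
  have h1 : IsClosed closedQuadrant :=
    (isClosed_le continuous_const continuous_fst).inter
      (isClosed_le continuous_const continuous_snd)
  exact h1.inter ((isClosed_le (continuous_crossForm _) continuous_const).inter
    (isClosed_le continuous_const (continuous_crossForm _)))

theorem convex_openSector (v : ℕ → ℤ × ℤ) (i : ℕ) : Convex ℝ (openSector v i) := by
  have h1 : Convex ℝ openQuadrant :=
    (convex_halfSpace_gt (LinearMap.fst ℝ ℝ ℝ).isLinear 0).inter
      (convex_halfSpace_gt (LinearMap.snd ℝ ℝ ℝ).isLinear 0)
  exact h1.inter ((convex_halfSpace_lt (crossForm (v i)).isLinear 0).inter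
    (convex_halfSpace_gt (crossForm (v (i + 1))).isLinear 0))

theorem crossForm_realVec_succ (v : ℕ → ℤ × ℤ) (i : ℕ) : crossForm (v i) (realVec (v (i + 1))) =
    -crossForm (v (i + 1)) (realVec (v i)) := by
  simp only [crossForm_apply, realVec]; ring

theorem crossForm_realVec_self (w : ℤ × ℤ) : crossForm w (realVec w) = 0 := by
  simp only [crossForm_apply, realVec]; ring

theorem isOpen_openSector (v : ℕ → ℤ × ℤ) (i : ℕ) : IsOpen (openSector v i) := by
  have h1 : IsOpen openQuadrant :=
    (isOpen_lt continuous_const continuous_fst).inter (isOpen_lt continuous_const continuous_snd)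
  exact h1.inter ((isOpen_lt (continuous_crossForm _) continuous_const).inter
    (isOpen_lt continuous_const (continuous_crossForm _)))

namespace IsRaySequence

variable {N : ℕ} {v : ℕ → ℤ × ℤ} (hv : IsRaySequence N v)
include hv

theorem fst_nonneg {i : ℕ} (hi : i ≤ N + 1) : 0 ≤ (v i).1 := by
  rcases Nat.eq_zero_or_pos i with rfl | h
  · exact hv.fst_zero.ge
  · exact (hv.fst_pos i h hi).le

theorem snd_nonneg {i : ℕ} (hi : i ≤ N + 1) : 0 ≤ (v i).2 := by
  rcases Nat.le_succ_iff.1 hi with h | rfl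
  · exact (hv.snd_pos i h).le
  · exact hv.snd_last.ge

theorem realVec_mem {i : ℕ} (hi : i ≤ N + 1) : realVec (v i) ∈ closedQuadrant :=
  ⟨Int.cast_nonneg (hv.fst_nonneg hi), Int.cast_nonneg (hv.snd_nonneg hi)⟩

theorem cross_pos {i : ℕ} (hi : i ≤ N) : 0 < crossForm (v (i + 1)) (realVec (v i)) := by
  have := hv.cross i hi
  rw [crossForm_apply, sub_pos, realVec]
  have h : ((v i).1 * (v (i + 1)).2 : ℝ) < (v (i + 1)).1 * (v i).2 := by exact_mod_cast this
  linarith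

/-- A vector on ray `i` or counterclockwise of it is strictly counterclockwise of ray `i + 1`. For
`v i` off the second axis this follows from `(v i).1 * (v (i+1) × x) = (v (i+1)).1 * (v i × x) + x.1
* (v (i+1) × v i)`. -/
theorem crossForm_succ_pos {i : ℕ} (hi : i ≤ N) {x : ℝ × ℝ} (hx : x ∈ closedQuadrant)
    (h0 : x ≠ 0) (h : 0 ≤ crossForm (v i) x) : 0 < crossForm (v (i + 1)) x := by
  have hc := hv.cross_pos hi
  rw [crossForm_apply] at h hc ⊢
  simp only [realVec] at hc
  obtain ⟨h1, h2⟩ := hx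
  have hA' : (0 : ℝ) < (v (i + 1)).1 := by exact_mod_cast hv.fst_pos (i + 1) (by omega) (by omega)
  have hB : (0 : ℝ) < (v i).2 := by exact_mod_cast hv.snd_pos i hi
  have hA : (0 : ℝ) ≤ (v i).1 := by exact_mod_cast hv.fst_nonneg (by omega)
  rcases hA.eq_or_lt with hA | hA
  · rw [← hA] at h
    have h3 : x.1 = 0 := by nlinarith
    have h4 : 0 < x.2 := h2.lt_of_ne fun h4 => h0 (Prod.ext h3 h4.symm)
    rw [h3]
    nlinarith [mul_pos hA' h4]
  · rcases h1.eq_or_lt with h3 | h3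
    · have h4 : 0 < x.2 := h2.lt_of_ne fun h4 => h0 (Prod.ext h3.symm h4.symm)
      rw [← h3]
      nlinarith [mul_pos hA' h4]
    · have key : 0 < (v i).1 * ((v (i + 1)).1 * x.2 - (v (i + 1)).2 * x.1) := by
        nlinarith [mul_pos h3 hc, mul_nonneg hA'.le h]
      exact pos_of_mul_pos_right key hA.le

theorem crossForm_pos_of_lt {i j : ℕ} (hij : i < j) (hj : j ≤ N + 1) {x : ℝ × ℝ}
    (hx : x ∈ closedQuadrant) (h0 : x ≠ 0) (h : 0 ≤ crossForm (v i) x) :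
    0 < crossForm (v j) x := by
  induction j, hij using Nat.le_induction with
  | base => exact hv.crossForm_succ_pos (by omega) hx h0 h
  | succ j hij ih => exact hv.crossForm_succ_pos (by omega) hx h0 (ih (by omega)).le

theorem crossForm_nonneg_of_le {i j : ℕ} (hij : i ≤ j) (hj : j ≤ N + 1) {x : ℝ × ℝ}
    (hx : x ∈ closedQuadrant) (h : 0 ≤ crossForm (v i) x) : 0 ≤ crossForm (v j) x := by
  rcases hij.eq_or_lt with rfl | hij
  · exact h
  · rcases eq_or_ne x 0 with rfl | h0
    · simp
    · exact (hv.crossForm_pos_of_lt hij hj hx h0 h).le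

theorem crossForm_nonpos_of_le {i j : ℕ} (hij : i ≤ j) (hj : j ≤ N + 1) {x : ℝ × ℝ}
    (hx : x ∈ closedQuadrant) (h : crossForm (v j) x ≤ 0) : crossForm (v i) x ≤ 0 := by
  by_contra! h'
  have h0 : x ≠ 0 := by rintro rfl; simp at h'
  rcases hij.eq_or_lt with rfl | hij
  · exact absurd h h'.not_ge
  · exact absurd h (hv.crossForm_pos_of_lt hij hj hx h0 h'.le).not_ge

/-- The sign conditions are monotone in the index. Rays (`i = j`) and the origin (`j < i`) count as
sectors, so all cones of the fan are treated alike. -/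
theorem sector_inter {i j i' j' : ℕ} (hi : i ≤ N + 1) (hj : j ≤ N + 1) (hi' : i' ≤ N + 1)
    (hj' : j' ≤ N + 1) : sector v i j ∩ sector v i' j' = sector v (max i i') (min j j') := by
  ext x
  constructor
  · rintro ⟨⟨hx, h1, h2⟩, ⟨-, h3, h4⟩⟩
    refine ⟨hx, ?_, ?_⟩
    · rcases max_choice i i' with h | h <;> rw [h] <;> assumption
    · rcases min_choice j j' with h | h <;> rw [h] <;> assumption
  · rintro ⟨hx, h1, h2⟩
    exact ⟨⟨hx, hv.crossForm_nonpos_of_le (le_max_left _ _) (max_le hi hi') hx h1,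
      hv.crossForm_nonneg_of_le (min_le_left _ _) hj hx h2⟩,
      ⟨hx, hv.crossForm_nonpos_of_le (le_max_right _ _) (max_le hi hi') hx h1,
      hv.crossForm_nonneg_of_le (min_le_right _ _) hj' hx h2⟩⟩

theorem sector_eq_zero {i j : ℕ} (hij : j < i) (hi : i ≤ N + 1) : sector v i j = {0} := by
  ext x
  constructor
  · rintro ⟨hx, h1, h2⟩
    by_contra h0
    exact absurd h1 (hv.crossForm_pos_of_lt hij hi hx h0 h2).not_ge
  · rintro rfl
    exact ⟨⟨le_rfl, le_rfl⟩, by simp, by simp⟩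

theorem realVec_mem_sector {i j k : ℕ} (hik : i ≤ k) (hkj : k ≤ j) (hj : j ≤ N + 1) :
    realVec (v k) ∈ sector v i j := by
  have h0 : crossForm (v k) (realVec (v k)) = 0 := by
    rw [crossForm_apply, realVec]; ring
  have hm := hv.realVec_mem (hkj.trans hj)
  exact ⟨hm, hv.crossForm_nonpos_of_le hik (hkj.trans hj) hm h0.le,
    hv.crossForm_nonneg_of_le hkj hj hm h0.ge⟩

/-- Cramer's rule for the basis formed by two consecutive rays. -/
theorem eq_add_of_crossForm {i : ℕ} (hi : i ≤ N) (x : ℝ × ℝ) :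
    x = (crossForm (v (i + 1)) x / crossForm (v (i + 1)) (realVec (v i))) • realVec (v i) +
      (-crossForm (v i) x / crossForm (v (i + 1)) (realVec (v i))) • realVec (v (i + 1)) := by
  have hc := (hv.cross_pos hi).ne'
  simp only [crossForm_apply, realVec] at hc ⊢
  ext
  · simp
    field_simp
    ring
  · simp
    field_simp
    ring

theorem mem_sector_iff {i j : ℕ} (hij : i ≤ j) (hji : j ≤ i + 1) (hj : j ≤ N + 1) {x : ℝ × ℝ} :
    x ∈ sector v i j ↔
      ∃ a b : ℝ, 0 ≤ a ∧ 0 ≤ b ∧ x = a • realVec (v i) + b • realVec (v j) := by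
  constructor
  · rintro ⟨hx, h1, h2⟩
    rcases hij.eq_or_lt with rfl | hlt
    · have h3 : crossForm (v i) x = 0 := le_antisymm h1 h2
      rw [crossForm_apply] at h3
      have hpos : 0 < ((v i).1 + (v i).2 : ℝ) := by
        have ha := hv.fst_nonneg hj
        have hb := hv.snd_nonneg hj
        have : 0 < (v i).1 + (v i).2 := by
          rcases Nat.eq_zero_or_pos i with rfl | h
          · have := hv.snd_pos 0 (by omega); omega
          · have := hv.fst_pos i h hj; omega
        exact_mod_cast this
      -- The ratio of coordinate sums is the scaling factor even for vectors on an axis, where a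
      -- ratio of single coordinates could be `0 / 0`.
      refine ⟨(x.1 + x.2) / ((v i).1 + (v i).2), 0,
        div_nonneg (add_nonneg hx.1 hx.2) hpos.le, le_rfl, ?_⟩
      ext
      · simp [realVec]
        field_simp
        linarith
      · simp [realVec]
        field_simp
        linarith
    · obtain rfl : j = i + 1 := by omega
      have hi : i ≤ N := by omega
      exact ⟨_, _, div_nonneg h2 (hv.cross_pos hi).le,
        div_nonneg (neg_nonneg.2 h1) (hv.cross_pos hi).le, hv.eq_add_of_crossForm hi x⟩
  · rintro ⟨a, b, ha, hb, rfl⟩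
    obtain ⟨h1, h2, h3⟩ := hv.realVec_mem_sector le_rfl hij hj
    obtain ⟨h4, h5, h6⟩ := hv.realVec_mem_sector hij le_rfl hj
    refine ⟨⟨?_, ?_⟩, ?_, ?_⟩
    · exact add_nonneg (mul_nonneg ha h1.1) (mul_nonneg hb h4.1)
    · exact add_nonneg (mul_nonneg ha h1.2) (mul_nonneg hb h4.2)
    · rw [map_add, map_smul, map_smul, smul_eq_mul, smul_eq_mul]
      nlinarith
    · rw [map_add, map_smul, map_smul, smul_eq_mul, smul_eq_mul]
      exact add_nonneg (mul_nonneg ha h3) (mul_nonneg hb h6)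

theorem isRationalCone_sector {i j : ℕ} (hi : i ≤ N + 1) (hj : j ≤ N + 1) (hji : j ≤ i + 1) :
    IsRationalCone (sector v i j) := by
  refine ⟨?_, fun x hx hx' => ?_⟩
  · rcases le_or_gt i j with hij | hij
    · refine ⟨2, ![v i, v j], Set.ext fun x => ?_⟩
      rw [hv.mem_sector_iff hij hji hj]
      constructor
      · rintro ⟨a, b, ha, hb, rfl⟩
        exact ⟨![a, b], by simp [Fin.forall_fin_two, ha, hb], by simp [Fin.sum_univ_two, realVec]⟩
      · rintro ⟨a, ha, rfl⟩
        exact ⟨a 0, a 1, ha 0, ha 1, by simp [Fin.sum_univ_two, realVec]⟩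
    · refine ⟨0, ![], ?_⟩
      rw [hv.sector_eq_zero hij hi]
      ext x
      constructor
      · rintro rfl
        exact ⟨![], by simp, by simp⟩
      · rintro ⟨a, -, rfl⟩
        simp
  · exact Prod.ext (le_antisymm (neg_nonneg.1 hx'.1.1) hx.1.1)
      (le_antisymm (neg_nonneg.1 hx'.1.2) hx.1.2)

/-- A form that is nonnegative on the sector has nonnegative values on the two generators, and the
face depends only on which of them vanish. Conversely, the rays are cut out by the cross forms and
the origin by the sum of the coordinates. -/
theorem isFace_sector_iff {i j : ℕ} (hi : i ≤ N + 1) (hj : j ≤ N + 1) (hji : j ≤ i + 1)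
    {F : Set (ℝ × ℝ)} :
    IsFace F (sector v i j) ↔ ∃ i' j', i ≤ i' ∧ i' ≤ N + 1 ∧ j' ≤ j ∧ F = sector v i' j' := by
  constructor
  · rintro ⟨f, hf, rfl⟩
    rcases le_or_gt i j with hij | hij
    swap
    · refine ⟨i, j, le_rfl, hi, le_rfl, ?_⟩
      rw [hv.sector_eq_zero hij hi]
      ext x
      simp only [Set.mem_ofPred_eq, Set.mem_singleton_iff, and_iff_left_iff_imp]
      rintro rfl
      simp
    have h1 := hf _ (hv.realVec_mem_sector le_rfl hij hj)
    have h2 := hf _ (hv.realVec_mem_sector hij le_rfl hj)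
    have zero : (0 : ℝ × ℝ) ∈ sector v i j := ⟨⟨le_rfl, le_rfl⟩, by simp, by simp⟩
    have hsub : ∀ i' j', i ≤ i' → j' ≤ j → i' ≤ N + 1 → sector v i' j' ⊆ sector v i j := by
      intro i' j' hi' hj' hi'' x hx
      exact ⟨hx.1, hv.crossForm_nonpos_of_le hi' hi'' hx.1 hx.2.1,
        hv.crossForm_nonneg_of_le hj' hj hx.1 hx.2.2⟩
    rcases h1.eq_or_lt with e1 | e1 <;> rcases h2.eq_or_lt with e2 | e2
    · refine ⟨i, j, le_rfl, hi, le_rfl, Set.ext fun x => ⟨fun h => h.1, fun h => ⟨h, ?_⟩⟩⟩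
      obtain ⟨a, b, -, -, rfl⟩ := (hv.mem_sector_iff hij hji hj).1 h
      simp [← e1, ← e2]
    · refine ⟨i, i, le_rfl, hi, hij, Set.ext fun x => ⟨fun ⟨h, h'⟩ => ?_, fun h => ⟨?_, ?_⟩⟩⟩
      · obtain ⟨a, b, ha, hb, rfl⟩ := (hv.mem_sector_iff hij hji hj).1 h
        simp only [map_add, map_smul, ← e1, smul_eq_mul, mul_zero, zero_add, mul_eq_zero,
          e2.ne', or_false] at h'
        exact (hv.mem_sector_iff le_rfl (by omega) hi).2 ⟨a, 0, ha, le_rfl, by simp [h']⟩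
      · exact hsub i i le_rfl hij hi h
      · obtain ⟨a, b, -, -, rfl⟩ := (hv.mem_sector_iff le_rfl (by omega) hi).1 h
        simp [← e1]
    · refine ⟨j, j, hij, hj, le_rfl, Set.ext fun x => ⟨fun ⟨h, h'⟩ => ?_, fun h => ⟨?_, ?_⟩⟩⟩
      · obtain ⟨a, b, ha, hb, rfl⟩ := (hv.mem_sector_iff hij hji hj).1 h
        simp only [map_add, map_smul, ← e2, smul_eq_mul, mul_zero, add_zero, mul_eq_zero,
          e1.ne', or_false] at h'
        exact (hv.mem_sector_iff le_rfl (by omega) hj).2 ⟨b, 0, hb, le_rfl, by simp [h']⟩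
      · exact hsub j j hij le_rfl hj h
      · obtain ⟨a, b, -, -, rfl⟩ := (hv.mem_sector_iff le_rfl (by omega) hj).1 h
        simp [← e2]
    -- The origin, as the sector with its bounds in the wrong order.
    · refine ⟨N + 1, 0, hi, le_rfl, by omega, ?_⟩
      rw [hv.sector_eq_zero (by omega) le_rfl]
      refine Set.eq_singleton_iff_unique_mem.2 ⟨⟨zero, map_zero f⟩, fun x ⟨h, h'⟩ => ?_⟩
      obtain ⟨a, b, ha, hb, rfl⟩ := (hv.mem_sector_iff hij hji hj).1 h
      rw [map_add, map_smul, map_smul, smul_eq_mul, smul_eq_mul,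
        add_eq_zero_iff_of_nonneg (mul_nonneg ha h1) (mul_nonneg hb h2)] at h'
      simp only [mul_eq_zero, e1.ne', e2.ne', or_false] at h'
      simp [h'.1, h'.2]
  · rintro ⟨i', j', hi', hi'', hj', rfl⟩
    have hset : ∀ x, x ∈ sector v i' j' ↔ x ∈ sector v i j ∧
        crossForm (v i') x ≤ 0 ∧ 0 ≤ crossForm (v j') x := fun x =>
      ⟨fun h => ⟨⟨h.1, hv.crossForm_nonpos_of_le hi' hi'' h.1 h.2.1,
        hv.crossForm_nonneg_of_le hj' hj h.1 h.2.2⟩, h.2⟩, fun h => ⟨h.1.1, h.2⟩⟩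
    rcases lt_or_ge j' i' with hlt | hge
    · refine ⟨LinearMap.fst ℝ ℝ ℝ + LinearMap.snd ℝ ℝ ℝ, fun x hx => add_nonneg hx.1.1 hx.1.2, ?_⟩
      rw [hv.sector_eq_zero hlt hi'']
      symm
      refine Set.eq_singleton_iff_unique_mem.2
        ⟨⟨⟨⟨le_rfl, le_rfl⟩, by simp, by simp⟩, map_zero _⟩, fun x ⟨h, h'⟩ => ?_⟩
      have := (add_eq_zero_iff_of_nonneg h.1.1 h.1.2).1 h'
      exact Prod.ext this.1 this.2
    · rcases hi'.eq_or_lt with rfl | hi'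
      · rcases hj'.eq_or_lt with rfl | hj'
        · exact ⟨0, fun x _ => le_rfl, by simp⟩
        · obtain rfl : i = j' := by omega
          refine ⟨-crossForm (v i), fun x hx => neg_nonneg.2 hx.2.1, Set.ext fun x => ?_⟩
          rw [hset]
          simp only [Set.mem_ofPred_eq, LinearMap.neg_apply, neg_eq_zero, and_congr_right_iff]
          exact fun _ => le_antisymm_iff.symm
      · obtain rfl : i' = j := by omega
        obtain rfl : j' = i' := by omega
        refine ⟨crossForm (v j'), fun x hx => hx.2.2, Set.ext fun x => ?_⟩
        rw [hset]
        simp only [Set.mem_ofPred_eq, and_congr_right_iff]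
        exact fun _ => le_antisymm_iff.symm

/-- The sectors between consecutive rays and their faces form a fan. -/
theorem isFan : IsFan {F | ∃ i ≤ N, IsFace F (sector v i (i + 1))} := by
  have hmem : ∀ F, F ∈ {F | ∃ i ≤ N, IsFace F (sector v i (i + 1))} ↔
      ∃ i j, i ≤ N + 1 ∧ j ≤ N + 1 ∧ j ≤ i + 1 ∧ F = sector v i j := by
    intro F
    constructor
    · rintro ⟨i, hi, hF⟩
      obtain ⟨i', j', h1, h2, h3, rfl⟩ :=
        (hv.isFace_sector_iff (by omega) (by omega) le_rfl).1 hF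
      exact ⟨i', j', h2, by omega, by omega, rfl⟩
    · rintro ⟨i, j, hi, hj, hji, rfl⟩
      rcases le_or_gt i N with h | h
      · exact ⟨i, h, (hv.isFace_sector_iff (by omega) (by omega) le_rfl).2
          ⟨i, j, le_rfl, by omega, hji, rfl⟩⟩
      · exact ⟨N, le_rfl, (hv.isFace_sector_iff (by omega) (by omega) le_rfl).2
          ⟨i, j, h.le, by omega, hj, rfl⟩⟩
  constructor
  · refine ((Set.finite_Iic (N + 1)).image2 (sector v) (Set.finite_Iic (N + 1))).subset ?_
    intro F hF
    obtain ⟨i, j, hi, hj, -, rfl⟩ := (hmem F).1 hF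
    exact ⟨i, hi, j, hj, rfl⟩
  · intro C hC
    obtain ⟨i, j, hi, hj, hji, rfl⟩ := (hmem C).1 hC
    exact hv.isRationalCone_sector hi hj hji
  · intro C hC F hF
    obtain ⟨i, j, hi, hj, hji, rfl⟩ := (hmem C).1 hC
    obtain ⟨i', j', h1, h2, h3, rfl⟩ := (hv.isFace_sector_iff hi hj hji).1 hF
    exact (hmem _).2 ⟨i', j', h2, by omega, by omega, rfl⟩
  · intro C hC D hD
    obtain ⟨i, j, hi, hj, hji, rfl⟩ := (hmem C).1 hC
    obtain ⟨i', j', hi', hj', hji', rfl⟩ := (hmem D).1 hD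
    rw [hv.sector_inter hi hj hi' hj', hv.isFace_sector_iff hi hj hji,
      hv.isFace_sector_iff hi' hj' hji']
    exact ⟨⟨_, _, le_max_left _ _, max_le hi hi', min_le_left _ _, rfl⟩,
      ⟨_, _, le_max_right _ _, max_le hi hi', min_le_right _ _, rfl⟩⟩

theorem crossForm_zero_neg {x : ℝ × ℝ} (hx : x ∈ openQuadrant) : crossForm (v 0) x < 0 := by
  have : (0 : ℝ) < (v 0).2 := by exact_mod_cast hv.snd_pos 0 (by omega)
  rw [crossForm_apply, hv.fst_zero]
  have := mul_pos this hx.1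
  simpa

theorem crossForm_last_pos {x : ℝ × ℝ} (hx : x ∈ openQuadrant) :
    0 < crossForm (v (N + 1)) x := by
  have : (0 : ℝ) < (v (N + 1)).1 := by exact_mod_cast hv.fst_pos (N + 1) (by omega) le_rfl
  rw [crossForm_apply, hv.snd_last]
  have := mul_pos this hx.2
  simpa

/-- The cross forms are nonpositive at the first ray and nonnegative at the last, so the sign
changes between some consecutive pair. -/
theorem exists_mem_sector {x : ℝ × ℝ} (hx : x ∈ closedQuadrant) :
    ∃ i ≤ N, x ∈ sector v i (i + 1) := by
  have h0 : crossForm (v 0) x ≤ 0 := by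
    have : (0 : ℝ) ≤ (v 0).2 := by exact_mod_cast (hv.snd_pos 0 (by omega)).le
    rw [crossForm_apply, hv.fst_zero]
    have := mul_nonneg this hx.1
    simpa
  have h1 : 0 ≤ crossForm (v (N + 1)) x := by
    have : (0 : ℝ) ≤ (v (N + 1)).1 := by exact_mod_cast (hv.fst_pos (N + 1) (by omega) le_rfl).le
    rw [crossForm_apply, hv.snd_last]
    have := mul_nonneg this hx.2
    simpa
  by_contra! h
  have : ∀ i ≤ N + 1, crossForm (v i) x ≤ 0 ∧ (0 < i → crossForm (v i) x < 0) := by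
    intro i
    induction i with
    | zero => exact fun _ => ⟨h0, fun h => absurd h (lt_irrefl _)⟩
    | succ i ih =>
      intro hi
      have h2 : crossForm (v (i + 1)) x < 0 := by
        by_contra! h3
        exact h i (by omega) ⟨hx, (ih (by omega)).1, h3⟩
      exact ⟨h2.le, fun _ => h2⟩
  exact absurd h1 ((this (N + 1) le_rfl).2 (by omega)).not_ge

theorem sUnion_faces : ⋃₀ {F | ∃ i ≤ N, IsFace F (sector v i (i + 1))} = closedQuadrant := by
  ext x
  constructor
  · rintro ⟨F, ⟨i, hi, f, hf, rfl⟩, hx⟩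
    exact hx.1.1
  · intro hx
    obtain ⟨i, hi, h⟩ := hv.exists_mem_sector hx
    exact ⟨_, ⟨i, hi, 0, fun _ _ => le_rfl, rfl⟩, h, rfl⟩

theorem mem_openSector_of_lt {i : ℕ} (hi : i ≤ N) {x : ℝ × ℝ} (h1 : crossForm (v i) x < 0)
    (h2 : 0 < crossForm (v (i + 1)) x) : x ∈ openSector v i := by
  refine ⟨?_, h1, h2⟩
  have hc := hv.cross_pos hi
  have hA : (0 : ℝ) ≤ (v i).1 := by exact_mod_cast hv.fst_nonneg (by omega)
  have hB : (0 : ℝ) < (v i).2 := by exact_mod_cast hv.snd_pos i hi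
  have hA' : (0 : ℝ) < (v (i + 1)).1 := by exact_mod_cast hv.fst_pos (i + 1) (by omega) (by omega)
  have hB' : (0 : ℝ) ≤ (v (i + 1)).2 := by exact_mod_cast hv.snd_nonneg (by omega)
  have ha := div_pos h2 hc
  have hb := div_pos (neg_pos.2 h1) hc
  rw [hv.eq_add_of_crossForm hi x]
  exact ⟨add_pos_of_nonneg_of_pos (mul_nonneg ha.le hA) (mul_pos hb hA'),
    add_pos_of_pos_of_nonneg (mul_pos ha hB) (mul_nonneg hb.le hB')⟩

/-- A push along the sum of the two generators makes both inequalities strict. Nonemptiness, closure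
and interior of the sectors all come from this. -/
theorem add_mem_openSector {i : ℕ} (hi : i ≤ N) {x : ℝ × ℝ} (hx : x ∈ sector v i (i + 1)) {ε : ℝ}
    (hε : 0 < ε) : x + ε • (realVec (v i) + realVec (v (i + 1))) ∈ openSector v i := by
  have hc := mul_pos hε (hv.cross_pos hi)
  apply hv.mem_openSector_of_lt hi
  · have := hx.2.1
    simp only [map_add, map_smul, smul_eq_mul, crossForm_realVec_self,
      crossForm_realVec_succ]
    linarith
  · have := hx.2.2
    simp only [map_add, map_smul, smul_eq_mul, crossForm_realVec_self]
    linarith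

theorem openSector_nonempty {i : ℕ} (hi : i ≤ N) : (openSector v i).Nonempty :=
  ⟨_, hv.add_mem_openSector hi (x := 0) ⟨⟨le_rfl, le_rfl⟩, by simp, by simp⟩ one_pos⟩

/-- Stated for any set between the open and the closed sector, because the region of a type contains
part of its boundary. -/
theorem closure_eq_sector {i : ℕ} (hi : i ≤ N) {S : Set (ℝ × ℝ)} (h1 : openSector v i ⊆ S)
    (h2 : S ⊆ sector v i (i + 1)) : closure S = sector v i (i + 1) := by
  refine Set.Subset.antisymm (closure_minimal h2 (isClosed_sector v i (i + 1))) fun x hx => ?_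
  refine closure_mono h1 ?_
  have hlim : Filter.Tendsto
      (fun ε : ℝ => x + ε • (realVec (v i) + realVec (v (i + 1)))) (nhdsWithin 0 (Set.Ioi 0))
      (nhds x) := by
    have : Continuous fun ε : ℝ => x + ε • (realVec (v i) + realVec (v (i + 1))) := by fun_prop
    have h := this.tendsto 0
    simp only [zero_smul, add_zero] at h
    exact h.mono_left nhdsWithin_le_nhds
  refine mem_closure_of_tendsto hlim ?_
  filter_upwards [self_mem_nhdsWithin] with ε hε
  exact hv.add_mem_openSector hi hx hε

theorem interior_sector {i : ℕ} (hi : i ≤ N) :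
    interior (sector v i (i + 1)) = openSector v i := by
  refine Set.Subset.antisymm (fun x hx => ?_)
    (interior_maximal (openSector_subset_sector v i) (isOpen_openSector v i))
  have hlim : Filter.Tendsto
      (fun ε : ℝ => x - ε • (realVec (v i) + realVec (v (i + 1)))) (nhdsWithin 0 (Set.Ioi 0))
      (nhds x) := by
    have : Continuous fun ε : ℝ => x - ε • (realVec (v i) + realVec (v (i + 1))) := by fun_prop
    have h := this.tendsto 0
    simp only [zero_smul, sub_zero] at h
    exact h.mono_left nhdsWithin_le_nhds
  -- An interior point can be pushed backwards a little inside the sector; pushing it forward again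
  -- lands in the open sector.
  have hev := (hlim.eventually (mem_interior_iff_mem_nhds.1 hx)).and self_mem_nhdsWithin
  obtain ⟨ε, h, hε⟩ := hev.exists
  simpa using hv.add_mem_openSector hi h hε

/-- The open sector is convex and avoids the walls. A connected set off the walls cannot leave it,
since by the intermediate value theorem one of the two bounding cross forms would vanish there. -/
theorem connectedComponentIn_eq_openSector {i : ℕ} (hi : i ≤ N) {x : ℝ × ℝ} (hx : x ∈ openSector v i) :
    connectedComponentIn
      (openQuadrant \ {x ∈ openQuadrant | ∃ j, 1 ≤ j ∧ j ≤ N ∧ crossForm (v j) x = 0}) x =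
      openSector v i := by
  have hsub : openSector v i ⊆
      openQuadrant \ {x ∈ openQuadrant | ∃ j, 1 ≤ j ∧ j ≤ N ∧ crossForm (v j) x = 0} := by
    rintro y ⟨hy, h1, h2⟩
    refine ⟨hy, ?_⟩
    rintro ⟨-, j, -, hj', hj⟩
    rcases le_or_gt j i with h | h
    · exact absurd h1 (hv.crossForm_nonneg_of_le h (by omega) (openQuadrant_subset hy) hj.ge).not_gt
    · exact absurd h2
        (hv.crossForm_nonpos_of_le (Nat.succ_le_of_lt h) (by omega) (openQuadrant_subset hy)
          hj.le).not_gt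
  refine Set.Subset.antisymm ?_
    ((convex_openSector v i).isPreconnected.subset_connectedComponentIn hx hsub)
  have hpre := isPreconnected_connectedComponentIn (F := openQuadrant \ {x ∈ openQuadrant |
    ∃ j, 1 ≤ j ∧ j ≤ N ∧ crossForm (v j) x = 0}) (x := x)
  have hxm := mem_connectedComponentIn (hsub hx)
  have hcs := connectedComponentIn_subset (openQuadrant \ {x ∈ openQuadrant |
    ∃ j, 1 ≤ j ∧ j ≤ N ∧ crossForm (v j) x = 0}) x
  have hne : ∀ j ≤ N + 1, ∀ y ∈ openQuadrant \ {x ∈ openQuadrant |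
      ∃ j, 1 ≤ j ∧ j ≤ N ∧ crossForm (v j) x = 0}, crossForm (v j) y ≠ 0 := by
    intro j hj y hy h0
    rcases Nat.eq_zero_or_pos j with rfl | hj0
    · exact (hv.crossForm_zero_neg hy.1).ne h0
    · rcases Nat.le_succ_iff.1 hj with h | rfl
      · exact hy.2 ⟨hy.1, j, hj0, h, h0⟩
      · exact (hv.crossForm_last_pos hy.1).ne' h0
  intro y hy
  refine ⟨(hcs hy).1, ?_, ?_⟩
  · by_contra! h
    obtain ⟨z, hz, hz0⟩ := hpre.intermediate_value hxm hy
      (continuous_crossForm (v i)).continuousOn ⟨hx.2.1.le, h⟩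
    exact hne i (by omega) z (hcs hz) hz0
  · by_contra! h
    obtain ⟨z, hz, hz0⟩ := hpre.intermediate_value hy hxm
      (continuous_crossForm (v (i + 1))).continuousOn ⟨h, hx.2.2.le⟩
    exact hne (i + 1) (by omega) z (hcs hz) hz0

theorem exists_mem_openSector {x : ℝ × ℝ} (hx : x ∈ openQuadrant \ {x ∈ openQuadrant |
      ∃ j, 1 ≤ j ∧ j ≤ N ∧ crossForm (v j) x = 0}) : ∃ i ≤ N, x ∈ openSector v i := by
  obtain ⟨i, hi, -, h1, h2⟩ := hv.exists_mem_sector (openQuadrant_subset hx.1)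
  refine ⟨i, hi, hx.1, h1.lt_of_ne fun h => ?_, h2.lt_of_ne fun h => ?_⟩
  · rcases Nat.eq_zero_or_pos i with rfl | h0
    · exact (hv.crossForm_zero_neg hx.1).ne h
    · exact hx.2 ⟨hx.1, i, h0, hi, h⟩
  · rcases hi.eq_or_lt with rfl | hi
    · exact (hv.crossForm_last_pos hx.1).ne h
    · exact hx.2 ⟨hx.1, i + 1, by omega, hi, h.symm⟩

/-- The closures of the pieces into which the inner rays subdivide the open quadrant. -/
theorem closures_eq : {C | ∃ x ∈ openQuadrant \ {x ∈ openQuadrant |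
      ∃ j, 1 ≤ j ∧ j ≤ N ∧ crossForm (v j) x = 0}, C = closure (connectedComponentIn
      (openQuadrant \ {x ∈ openQuadrant | ∃ j, 1 ≤ j ∧ j ≤ N ∧ crossForm (v j) x = 0}) x)} =
    {C | ∃ i ≤ N, C = sector v i (i + 1)} := by
  have hcl : ∀ i ≤ N, closure (openSector v i) = sector v i (i + 1) := fun i hi =>
    hv.closure_eq_sector hi subset_rfl (openSector_subset_sector v i)
  ext C
  constructor
  · rintro ⟨x, hx, rfl⟩
    obtain ⟨i, hi, h⟩ := hv.exists_mem_openSector hx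
    exact ⟨i, hi, by rw [hv.connectedComponentIn_eq_openSector hi h, hcl i hi]⟩
  · rintro ⟨i, hi, rfl⟩
    obtain ⟨x, hx⟩ := hv.openSector_nonempty hi
    have h := hv.connectedComponentIn_eq_openSector hi hx
    have hxm : x ∈ connectedComponentIn (openQuadrant \ {x ∈ openQuadrant |
      ∃ j, 1 ≤ j ∧ j ≤ N ∧ crossForm (v j) x = 0}) x := by rw [h]; exact hx
    exact ⟨x, connectedComponentIn_subset _ _ hxm, by rw [h, hcl i hi]⟩

theorem eq_succ_of_mem_sector {i j : ℕ} (hij : i < j) (hj : j ≤ N) {x : ℝ × ℝ} (h0 : x ≠ 0)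
    (hi : x ∈ sector v i (i + 1)) (h : x ∈ sector v j (j + 1)) :
    j = i + 1 := by
  by_contra hne
  exact absurd h.2.1
    (hv.crossForm_pos_of_lt (by omega : i + 1 < j) (by omega) hi.1 h0 hi.2.2).not_ge

theorem mem_openQuadrant_of_crossForm_eq_zero {i : ℕ} (h1 : 1 ≤ i) (hi : i ≤ N) {x : ℝ × ℝ}
    (hx : x ∈ closedQuadrant) (h0 : x ≠ 0) (h : crossForm (v i) x = 0) : x ∈ openQuadrant := by
  have hA : (0 : ℝ) < (v i).1 := by exact_mod_cast hv.fst_pos i h1 (by omega)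
  have hB : (0 : ℝ) < (v i).2 := by exact_mod_cast hv.snd_pos i hi
  rw [crossForm_apply, sub_eq_zero] at h
  refine ⟨hx.1.lt_of_ne fun h2 => h0 ?_, hx.2.lt_of_ne fun h2 => h0 ?_⟩
  · rw [← h2, mul_zero, mul_eq_zero] at h
    exact Prod.ext h2.symm (h.resolve_left hA.ne')
  · rw [← h2, mul_zero, eq_comm, mul_eq_zero] at h
    exact Prod.ext (h.resolve_left hB.ne') h2.symm

theorem sector_injective {i j : ℕ} (hi : i ≤ N) (hj : j ≤ N)
    (h : sector v i (i + 1) = sector v j (j + 1)) : i = j := by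
  have key : ∀ {i j : ℕ}, i ≤ N → j ≤ N → sector v i (i + 1) = sector v j (j + 1) → ¬i < j := by
    intro i j hi hj h hlt
    obtain ⟨x, hx⟩ := hv.openSector_nonempty hi
    have hm : x ∈ sector v j (j + 1) := h ▸ openSector_subset_sector v i hx
    exact absurd hx.2.2 (hv.crossForm_nonpos_of_le hlt (by omega) hm.1 hm.2.1).not_gt
  have h1 := key hi hj h
  have h2 := key hj hi h.symm
  omega

end IsRaySequence

/-! ### Selling reduction of the matrices `Qpp d k x` as a subtractive Euclidean algorithm -/

/-- A basis `(u, v)` of `ℤ²` is recorded through `(p₁, s₁) = (d u₁ - k u₂, u₂)` and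
`(-p₂, s₂) = (d v₁ - k v₂, v₂)`, coordinates in which `d • Qpp d k x` is diagonal. -/
structure EuclidState where
  p₁ : ℤ
  s₁ : ℤ
  p₂ : ℤ
  s₂ : ℤ

namespace EuclidState

/-- The next move of Selling's algorithm, if there is one. -/
def move (S : EuclidState) : SellingMove := if S.p₂ < S.p₁ then .alpha else .beta

/-- In case of a tie `p₂` is reduced, so `p₁` stays positive and the algorithm ends with `p₂ = 0`.
The determinant `s₁ p₂ + s₂ p₁` of the basis is preserved. -/
def next (S : EuclidState) : EuclidState :=
  if S.p₂ < S.p₁ then ⟨S.p₁ - S.p₂, S.s₁ + S.s₂, S.p₂, S.s₂⟩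
  else ⟨S.p₁, S.s₁, S.p₂ - S.p₁, S.s₁ + S.s₂⟩

/-- The vector on whose ray the two elements of the basis are orthogonal. -/
def vec (S : EuclidState) : ℤ × ℤ := (S.s₁ * S.s₂, S.p₁ * S.p₂)

/-- The matrix of the form in the basis that is recorded by the state. -/
noncomputable def matrix (d : ℕ) (S : EuclidState) (x : ℝ × ℝ) : Matrix (Fin 2) (Fin 2) ℝ :=
  !![(S.p₁ ^ 2 * x.1 + S.s₁ ^ 2 * x.2) / d, (S.s₁ * S.s₂ * x.2 - S.p₁ * S.p₂ * x.1) / d;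
    (S.s₁ * S.s₂ * x.2 - S.p₁ * S.p₂ * x.1) / d, (S.p₂ ^ 2 * x.1 + S.s₂ ^ 2 * x.2) / d]

/-- The negatives of the Selling parameters. -/
noncomputable def lengths (d : ℕ) (S : EuclidState) : ℝ × ℝ →ₗ[ℝ] (Fin 3 → ℝ) :=
  LinearMap.pi ![-((d : ℝ)⁻¹ • crossForm S.vec),
    (d : ℝ)⁻¹ • crossForm (S.s₁ * (S.s₁ + S.s₂), S.p₁ * (S.p₂ - S.p₁)),
    (d : ℝ)⁻¹ • crossForm (S.s₂ * (S.s₁ + S.s₂), S.p₂ * (S.p₁ - S.p₂))]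

/-- The word of the first `n` moves. -/
def word : EuclidState → ℕ → List SellingMove
  | _, 0 => []
  | S, n + 1 => S.move :: word S.next n

theorem length_word (S : EuclidState) (n : ℕ) : (S.word n).length = n := by
  induction n generalizing S with
  | zero => rfl
  | succ n ih => simp [word, ih]

structure IsPos (S : EuclidState) : Prop where
  p₁ : 0 < S.p₁
  s₁ : 0 ≤ S.s₁
  p₂ : 0 ≤ S.p₂
  s₂ : 0 < S.s₂

theorem IsPos.step {S : EuclidState} (h : S.IsPos) : S.next.IsPos := by
  obtain ⟨h1, h2, h3, h4⟩ := h
  unfold EuclidState.next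
  split_ifs with hlt
  · exact ⟨by dsimp only; omega, by dsimp only; omega, h3, h4⟩
  · exact ⟨h1, h2, by dsimp only; omega, by dsimp only; omega⟩

theorem lengths_zero (d : ℕ) (S : EuclidState) (x : ℝ × ℝ) :
    S.lengths d x 0 = -((d : ℝ)⁻¹ * crossForm S.vec x) := rfl

theorem lengths_one (d : ℕ) (S : EuclidState) (x : ℝ × ℝ) :
    S.lengths d x 1 =
      (d : ℝ)⁻¹ * crossForm (S.s₁ * (S.s₁ + S.s₂), S.p₁ * (S.p₂ - S.p₁)) x := rfl

theorem lengths_two (d : ℕ) (S : EuclidState) (x : ℝ × ℝ) :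
    S.lengths d x 2 =
      (d : ℝ)⁻¹ * crossForm (S.s₂ * (S.s₁ + S.s₂), S.p₂ * (S.p₁ - S.p₂)) x := rfl

theorem matrix_zero_one (d : ℕ) (S : EuclidState) (x : ℝ × ℝ) :
    S.matrix d x 0 1 = -S.lengths d x 0 := by
  simp [lengths_zero, matrix, crossForm_apply, vec]
  ring

theorem selling13_matrix (d : ℕ) (S : EuclidState) (x : ℝ × ℝ) :
    selling13 (S.matrix d x) = -S.lengths d x 1 := by
  simp [lengths_one, matrix, crossForm_apply, selling13]
  ring

theorem selling23_matrix (d : ℕ) (S : EuclidState) (x : ℝ × ℝ) :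
    selling23 (S.matrix d x) = -S.lengths d x 2 := by
  simp [lengths_two, matrix, crossForm_apply, selling23]
  ring

theorem matrix_isSymm (d : ℕ) (S : EuclidState) (x : ℝ × ℝ) : (S.matrix d x).IsSymm := by
  ext i j
  fin_cases i <;> fin_cases j <;> rfl

theorem matrix_next (d : ℕ) (S : EuclidState) (x : ℝ × ℝ) :
    S.move.matrix.transpose * S.matrix d x * S.move.matrix = S.next.matrix d x := by
  unfold move next
  split_ifs with h
  · ext i j
    fin_cases i <;> fin_cases j <;>
      simp [SellingMove.matrix, matrix, Matrix.mul_apply, Fin.sum_univ_two] <;> ring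
  · ext i j
    fin_cases i <;> fin_cases j <;>
      simp [SellingMove.matrix, matrix, Matrix.mul_apply, Fin.sum_univ_two] <;> ring

/-- The index of the length that decides whether Selling's algorithm goes on. -/
def index (S : EuclidState) : Fin 3 := if S.p₂ < S.p₁ then 2 else 1

/-- The move replaces one basis vector by the sum `u + v`. The parameter that triggers it is, up to
sign, the product of `u + v` with the vector that is kept, that is, the off-diagonal entry of the
next matrix. -/
theorem lengths_index (d : ℕ) (S : EuclidState) (x : ℝ × ℝ) :
    S.lengths d x S.index = (d : ℝ)⁻¹ * crossForm S.next.vec x := by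
  unfold index next
  split_ifs with h
  · simp [lengths_two, crossForm_apply, vec]
    left; ring
  · simp [lengths_one, crossForm_apply, vec]

/-- This length is the product of `u + v` with the basis vector having the larger `p` (with `v` in
case of a tie). These two lie in a common quadrant of the diagonal coordinates, so the sign does not
depend on `x`. -/
theorem lengths_nonneg {d : ℕ} {S : EuclidState} (hS : S.IsPos) {x : ℝ × ℝ}
    (hx : x ∈ closedQuadrant) {i : Fin 3} (h0 : i ≠ 0) (hi : i ≠ S.index) :
    0 ≤ S.lengths d x i := by
  obtain ⟨h1, h2, h3, h4⟩ := hS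
  obtain ⟨hx1, hx2⟩ := hx
  have e2 : (0 : ℝ) ≤ S.s₁ := by exact_mod_cast h2
  have e3 : (0 : ℝ) ≤ S.p₂ := by exact_mod_cast h3
  have e4 : (0 : ℝ) < S.s₂ := by exact_mod_cast h4
  have e1 : (0 : ℝ) < S.p₁ := by exact_mod_cast h1
  unfold index at hi
  split_ifs at hi with h
  · obtain rfl : i = 1 := by omega
    have h' : (S.p₂ : ℝ) < S.p₁ := by exact_mod_cast h
    rw [lengths_one, crossForm_apply]
    push_cast
    refine mul_nonneg (by positivity) ?_
    have := mul_nonneg (mul_nonneg e1.le (sub_pos.2 h').le) hx1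
    have := mul_nonneg (mul_nonneg e2 (by linarith : (0 : ℝ) ≤ S.s₁ + S.s₂)) hx2
    linarith
  · obtain rfl : i = 2 := by omega
    have h' : (S.p₁ : ℝ) ≤ S.p₂ := by exact_mod_cast not_lt.1 h
    rw [lengths_two, crossForm_apply]
    push_cast
    refine mul_nonneg (by positivity) ?_
    have := mul_nonneg (mul_nonneg e3 (sub_nonneg.2 h')) hx1
    have := mul_nonneg (mul_nonneg e4.le (by linarith : (0 : ℝ) ≤ S.s₁ + S.s₂)) hx2
    linarith

theorem lengths_pos {d : ℕ} (hd : d ≠ 0) {S : EuclidState} (hS : S.IsPos) {x : ℝ × ℝ}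
    (hx : x ∈ openQuadrant) {i : Fin 3} (h0 : i ≠ 0) (hi : i ≠ S.index) :
    0 < S.lengths d x i := by
  obtain ⟨h1, h2, h3, h4⟩ := hS
  obtain ⟨hx1, hx2⟩ := hx
  have e2 : (0 : ℝ) ≤ S.s₁ := by exact_mod_cast h2
  have e3 : (0 : ℝ) ≤ S.p₂ := by exact_mod_cast h3
  have e4 : (0 : ℝ) < S.s₂ := by exact_mod_cast h4
  have e1 : (0 : ℝ) < S.p₁ := by exact_mod_cast h1
  unfold index at hi
  split_ifs at hi with h
  · obtain rfl : i = 1 := by omega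
    have h' : (S.p₂ : ℝ) < S.p₁ := by exact_mod_cast h
    rw [lengths_one, crossForm_apply]
    push_cast
    refine mul_pos (by positivity) ?_
    have := mul_pos (mul_pos e1 (sub_pos.2 h')) hx1
    have := mul_nonneg (mul_nonneg e2 (by linarith : (0 : ℝ) ≤ S.s₁ + S.s₂)) hx2.le
    linarith
  · obtain rfl : i = 2 := by omega
    have h' : (S.p₁ : ℝ) ≤ S.p₂ := by exact_mod_cast not_lt.1 h
    rw [lengths_two, crossForm_apply]
    push_cast
    refine mul_pos (by positivity) ?_
    have := mul_nonneg (mul_nonneg e3 (sub_nonneg.2 h')) hx1.le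
    have := mul_pos (mul_pos e4 (by linarith : (0 : ℝ) < S.s₁ + S.s₂)) hx2
    linarith

theorem hasSellingType_word {d : ℕ} (hd : d ≠ 0) {x : ℝ × ℝ} (hx : x ∈ openQuadrant) (n : ℕ)
    {S : EuclidState} (hS : S.IsPos)
    (hlt : ∀ j, 1 ≤ j → j ≤ n → crossForm (next^[j] S).vec x < 0)
    (hle : 0 ≤ crossForm (next^[n + 1] S).vec x) :
    HasSellingType (S.matrix d x) (S.word n) := by
  have hd' : (0 : ℝ) < (d : ℝ)⁻¹ := by positivity
  induction n generalizing S with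
  | zero =>
    have h1 := S.lengths_index d x
    have h2 : ∀ i : Fin 3, i ≠ 0 → 0 ≤ S.lengths d x i := fun i hi => by
      rcases eq_or_ne i S.index with rfl | hne
      · rw [h1]
        exact mul_nonneg hd'.le hle
      · exact lengths_nonneg hS (openQuadrant_subset hx) hi hne
    refine .reduced _ ?_ ?_
    · rw [selling13_matrix, neg_nonpos]
      exact h2 1 (by decide)
    · rw [selling23_matrix, neg_nonpos]
      exact h2 2 (by decide)
  | succ n ih =>
    have h1 : S.lengths d x S.index < 0 := by
      rw [lengths_index]
      exact mul_neg_of_pos_of_neg hd' (hlt 1 le_rfl (by omega))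
    have h2 := ih hS.step (fun j hj hj' => hlt (j + 1) (by omega) (by omega)) hle
    rw [← matrix_next] at h2
    rw [word]
    unfold index at h1
    unfold move at h2 ⊢
    split_ifs at h1 h2 ⊢ with h
    · exact .alpha _ _ (by rw [selling23_matrix]; linarith) h2
    · exact .beta _ _ (by rw [selling13_matrix]; linarith) h2

/-- On the open quadrant the other outer parameter is strictly negative, so the algorithm has no
choice: its move is dictated by the state. -/
theorem hasSellingType_cons {d : ℕ} (hd : d ≠ 0) {x : ℝ × ℝ} (hx : x ∈ openQuadrant)
    {m : SellingMove} {w : List SellingMove} {S : EuclidState} (hS : S.IsPos)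
    (h : HasSellingType (S.matrix d x) (m :: w)) :
    m = S.move ∧ crossForm S.next.vec x < 0 ∧ HasSellingType (S.next.matrix d x) w := by
  have hd' : (0 : ℝ) < (d : ℝ)⁻¹ := by positivity
  have hneg : ∀ i : Fin 3, i ≠ 0 → S.lengths d x i < 0 →
      S.index = i ∧ crossForm S.next.vec x < 0 := by
    intro i hi hlt
    by_cases hne : S.index = i
    · rw [← hne, lengths_index] at hlt
      exact ⟨hne, (pos_iff_neg_of_mul_neg hlt).1 hd'⟩
    · exact absurd hlt (lengths_pos hd hS hx hi (Ne.symm hne)).not_gt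
  rw [← matrix_next]
  cases h with
  | beta _ _ h1 h2 =>
    rw [selling13_matrix, neg_pos] at h1
    obtain ⟨hi, hc⟩ := hneg 1 (by decide) h1
    have hm : SellingMove.beta = S.move := by
      unfold index at hi
      split_ifs at hi with h
      · exact absurd hi (by decide)
      · rw [move, if_neg h]
    exact ⟨hm, hc, hm ▸ h2⟩
  | alpha _ _ h1 h2 =>
    rw [selling23_matrix, neg_pos] at h1
    obtain ⟨hi, hc⟩ := hneg 2 (by decide) h1
    have hm : SellingMove.alpha = S.move := by
      unfold index at hi
      split_ifs at hi with h
      · rw [move, if_pos h]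
      · exact absurd hi (by decide)
    exact ⟨hm, hc, hm ▸ h2⟩

/-- The type is determined by its length: `x` enters only through the moment of stopping. -/
theorem exists_eq_word {d : ℕ} (hd : d ≠ 0) {x : ℝ × ℝ} (hx : x ∈ openQuadrant)
    {w : List SellingMove} {S : EuclidState} (hS : S.IsPos)
    (h : HasSellingType (S.matrix d x) w) :
    ∃ n, w = S.word n ∧ 0 ≤ crossForm (next^[n + 1] S).vec x ∧
      (n ≠ 0 → crossForm (next^[n] S).vec x < 0) := by
  have hd' : (0 : ℝ) < (d : ℝ)⁻¹ := by positivity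
  induction w generalizing S with
  | nil =>
    cases h with
    | reduced _ h1 h2 =>
      refine ⟨0, rfl, ?_, fun h => absurd rfl h⟩
      have hidx := S.lengths_index d x
      have : 0 ≤ S.lengths d x S.index := by
        rw [selling13_matrix, neg_nonpos] at h1
        rw [selling23_matrix, neg_nonpos] at h2
        unfold index
        split_ifs <;> assumption
      rw [hidx] at this
      exact nonneg_of_mul_nonneg_right this hd'
  | cons m w ih =>
    obtain ⟨rfl, hneg, hw⟩ := hasSellingType_cons hd hx hS h
    obtain ⟨n, rfl, h1, h2⟩ := ih hS.step hw
    refine ⟨n + 1, rfl, h1, fun _ => ?_⟩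
    rcases eq_or_ne n 0 with rfl | hn
    · exact hneg
    · exact h2 hn

/-! ### The sequence of states -/

theorem iterate_succ (S : EuclidState) (n : ℕ) : next^[n + 1] S = (next^[n] S).next :=
  Function.iterate_succ_apply' next n S

theorem IsPos.iterate {S : EuclidState} (h : S.IsPos) (n : ℕ) : (next^[n] S).IsPos := by
  induction n with
  | zero => exact h
  | succ n ih => rw [iterate_succ]; exact ih.step

/-- The difference of the two sides is the determinant `s₁ p₂ + s₂ p₁` times `p₂ s₂` for the move
`alpha`, and times `s₁ p₁` for `beta`. The alternative in the hypotheses excludes `beta` with `s₁ =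
0`, where consecutive rays would coincide. -/
theorem IsPos.cross_lt {S : EuclidState} (h : S.IsPos) (h0 : 0 < S.p₂)
    (h1 : S.p₂ < S.p₁ ∨ 0 < S.s₁) :
    S.vec.1 * S.next.vec.2 < S.next.vec.1 * S.vec.2 := by
  obtain ⟨hp₁, hs₁, hp₂, hs₂⟩ := h
  have hpos : 0 < S.s₁ * S.p₂ + S.s₂ * S.p₁ :=
    add_pos_of_nonneg_of_pos (mul_nonneg hs₁ hp₂) (mul_pos hs₂ hp₁)
  unfold vec next
  split_ifs with hlt
  · have := mul_pos (mul_pos h0 hs₂) hpos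
    dsimp only
    nlinarith
  · have := mul_pos (mul_pos (h1.resolve_left hlt) hp₁) hpos
    dsimp only
    nlinarith

theorem IsPos.exists_p₂_eq_zero {S : EuclidState} (h : S.IsPos) :
    ∃ n, (next^[n] S).p₂ = 0 := by
  -- The sum `p₁ + p₂` drops with every move as long as `p₂` is positive.
  obtain ⟨m, hm⟩ : ∃ m : ℕ, S.p₁ + S.p₂ ≤ m := ⟨(S.p₁ + S.p₂).toNat, Int.self_le_toNat _⟩
  induction m generalizing S with
  | zero =>
    have := h.p₁
    have := h.p₂
    push_cast at hm
    omega
  | succ m ih =>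
    rcases h.p₂.eq_or_lt with h0 | h0
    · exact ⟨0, h0.symm⟩
    · obtain ⟨n, hn⟩ := ih h.step (by
        have := h.p₁
        push_cast at hm
        unfold next
        split_ifs <;> dsimp only <;> omega)
      exact ⟨n + 1, hn⟩

theorem p₂_next {S : EuclidState} (h : S.IsPos) (h0 : S.p₂ = 0) : S.next.p₂ = 0 := by
  have := h.p₁
  rw [next, if_pos (by omega)]
  exact h0

theorem s₁_le_next {S : EuclidState} (h : S.IsPos) : S.s₁ ≤ S.next.s₁ := by
  have := h.s₂
  unfold next
  split_ifs <;> dsimp only <;> omega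

/-- The initial state, for the standard basis. -/
def start (d k : ℕ) : EuclidState := ⟨d, 0, k, 1⟩

section Start

variable {d k : ℕ} (hk : 0 < k) (hkd : k < d)
include hk hkd

theorem start_isPos : (start d k).IsPos :=
  ⟨by simp only [start]; omega, le_rfl, by simp only [start]; omega, one_pos⟩

/-- Since `k < d`, the first move is `alpha`, which makes `s₁ = 1`; no move decreases `s₁`. -/
theorem s₁_pos {n : ℕ} (hn : 1 ≤ n) : 0 < (next^[n] (start d k)).s₁ := by
  induction n, hn using Nat.le_induction with
  | base =>
    rw [iterate_succ, Function.iterate_zero_apply, next, if_pos (by simp only [start]; omega)]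
    simp [start]
  | succ n _ ih =>
    rw [iterate_succ]
    exact ih.trans_le (s₁_le_next ((start_isPos hk hkd).iterate n))

/-- The rays on which Selling's algorithm meets a matrix with an orthogonal basis. -/
theorem exists_isRaySequence : ∃ N,
    IsRaySequence N (fun n => (next^[n] (start d k)).vec) ∧
    ∀ n, N < n → (next^[n] (start d k)).p₂ = 0 := by
  have hS := start_isPos hk hkd
  have hex := hS.exists_p₂_eq_zero
  classical
  have hspec := Nat.find_spec hex
  have hmin : ∀ n, n < Nat.find hex → 0 < (next^[n] (start d k)).p₂ := fun n hn =>
    (hS.iterate n).p₂.lt_of_ne fun h => Nat.find_min hex hn h.symm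
  -- The last ray, with index `N + 1`, belongs to the first state with `p₂ = 0`; this is not the
  -- initial state because `k > 0`.
  obtain ⟨N, hN⟩ : ∃ N, Nat.find hex = N + 1 := by
    refine Nat.exists_eq_succ_of_ne_zero fun h0 => ?_
    rw [h0] at hspec
    simp [start] at hspec
    omega
  rw [hN] at hspec hmin
  refine ⟨N, ⟨by simp [start, vec], ?_, fun i hi _ => ?_, fun i hi => ?_,
    fun i hi => ?_⟩, fun n hn => ?_⟩
  · change _ * (next^[N + 1] (start d k)).p₂ = 0
    rw [hspec, mul_zero]
  · exact mul_pos (s₁_pos hk hkd hi) (hS.iterate i).s₂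
  · exact mul_pos (hS.iterate i).p₁ (hmin i (by omega))
  · simp only [iterate_succ]
    refine (hS.iterate i).cross_lt (hmin i (by omega)) ?_
    rcases Nat.eq_zero_or_pos i with rfl | h0
    · left
      simp only [start, Function.iterate_zero_apply]
      omega
    · exact Or.inr (s₁_pos hk hkd h0)
  · induction n, hn using Nat.le_induction with
    | base => exact hspec
    | succ n _ ih =>
      rw [iterate_succ]
      exact p₂_next (hS.iterate n) ih

end Start

end EuclidState

/-! ### Matrices of theta curves -/

/-- A matrix in the cone `σ` is the matrix of a theta curve, whose lengths are the negatives of the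
Selling parameters. -/
theorem hasMatrix_of_mem_sigmaCone {Q : Matrix (Fin 2) (Fin 2) ℝ} (hQ : Q ∈ sigmaCone) :
    (CurveTwo.jac ⟨.theta, fun i => (![-Q 0 1, -selling13 Q, -selling23 Q] i).toNNReal⟩).HasMatrix
      Q := by
  obtain ⟨hs, h0, h1, h2⟩ := hQ
  have h := theta_hasMatrix fun i => (![-Q 0 1, -selling13 Q, -selling23 Q] i).toNNReal
  convert h using 1
  have h10 : Q 1 0 = Q 0 1 := hs.apply 0 1
  ext i j
  fin_cases i <;> fin_cases j <;>
    simp [h0, h1, h2, Real.coe_toNNReal', h10] <;> simp [selling13, selling23]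

/-- The equivalence `e` below multiplies coordinates by the matrix of the move, so it yields the
basis transformed by the inverse matrix. -/
theorem PPTav.HasMatrix.of_basis_change {T : PPTav} {Q : Matrix (Fin 2) (Fin 2) ℝ}
    (m : SellingMove) (h : T.HasMatrix (m.matrix.transpose * Q * m.matrix)) : T.HasMatrix Q := by
  obtain ⟨b, hb⟩ := h
  cases m
  · let e : (Fin 2 → ℤ) ≃ₗ[ℤ] (Fin 2 → ℤ) :=
      { toFun := fun a => ![a 0, a 0 + a 1]
        invFun := fun a => ![a 0, a 1 - a 0]
        map_add' := fun a c => by ext i; fin_cases i <;> simp; ring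
        map_smul' := fun n a => by ext i; fin_cases i <;> simp; ring
        left_inv := fun a => by ext i; fin_cases i <;> simp
        right_inv := fun a => by ext i; fin_cases i <;> simp }
    refine ⟨Module.Basis.ofEquivFun (b.equivFun.trans e), fun i j => ?_⟩
    have c0 : Module.Basis.ofEquivFun (b.equivFun.trans e) 0 = b 0 - b 1 := by
      simp [e, Fin.sum_univ_two, Module.Basis.equivFun_symm_apply, sub_eq_add_neg]
    have c1 : Module.Basis.ofEquivFun (b.equivFun.trans e) 1 = b 1 := by
      simp [e, Fin.sum_univ_two, Module.Basis.equivFun_symm_apply]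
    fin_cases i <;> fin_cases j <;>
      simp [c0, c1, form_sub_left, form_sub_right, hb, SellingMove.matrix, Matrix.mul_apply,
        Fin.sum_univ_two] <;> ring
  · let e : (Fin 2 → ℤ) ≃ₗ[ℤ] (Fin 2 → ℤ) :=
      { toFun := fun a => ![a 0 + a 1, a 1]
        invFun := fun a => ![a 0 - a 1, a 1]
        map_add' := fun a c => by ext i; fin_cases i <;> simp; ring
        map_smul' := fun n a => by ext i; fin_cases i <;> simp; ring
        left_inv := fun a => by ext i; fin_cases i <;> simp
        right_inv := fun a => by ext i; fin_cases i <;> simp }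
    refine ⟨Module.Basis.ofEquivFun (b.equivFun.trans e), fun i j => ?_⟩
    have c0 : Module.Basis.ofEquivFun (b.equivFun.trans e) 0 = b 0 := by
      simp [e, Fin.sum_univ_two, Module.Basis.equivFun_symm_apply]
    have c1 : Module.Basis.ofEquivFun (b.equivFun.trans e) 1 = b 1 - b 0 := by
      simp [e, Fin.sum_univ_two, Module.Basis.equivFun_symm_apply, sub_eq_neg_add]
    fin_cases i <;> fin_cases j <;>
      simp [c0, c1, form_sub_left, form_sub_right, hb, SellingMove.matrix, Matrix.mul_apply,
        Fin.sum_univ_two] <;> ring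

namespace EuclidState

theorem matrix_start {d : ℕ} (hd : d ≠ 0) (k : (ZMod d)ˣ) (x : ℝ × ℝ) :
    (start d (k : ZMod d).val).matrix d x = Qpp d k x := by
  have hd' : (d : ℝ) ≠ 0 := by exact_mod_cast hd
  ext i j
  fin_cases i <;> fin_cases j <;> simp [start, matrix, Qpp] <;> field_simp

theorem hasMatrix_of_iterate {d : ℕ} {S : EuclidState} {x : ℝ × ℝ} {T : PPTav} (n : ℕ)
    (h : T.HasMatrix ((next^[n] S).matrix d x)) : T.HasMatrix (S.matrix d x) := by
  induction n with
  | zero => exact h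
  | succ n ih =>
    rw [iterate_succ, ← matrix_next] at h
    exact ih (h.of_basis_change _)

theorem lengths_eq (d : ℕ) (S : EuclidState) (x : ℝ × ℝ) :
    ![-S.matrix d x 0 1, -selling13 (S.matrix d x), -selling23 (S.matrix d x)] =
      S.lengths d x := by
  rw [matrix_zero_one, selling13_matrix, selling23_matrix]
  ext i
  fin_cases i <;> simp

theorem matrix_mem_sigmaCone {d : ℕ} {S : EuclidState} {x : ℝ × ℝ}
    (h : ∀ i, 0 ≤ S.lengths d x i) : S.matrix d x ∈ sigmaCone := by
  refine ⟨matrix_isSymm d S x, ?_, ?_, ?_⟩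
  · rw [matrix_zero_one]; linarith [h 0]
  · rw [selling13_matrix]; linarith [h 1]
  · rw [selling23_matrix]; linarith [h 2]

theorem theta_hasMatrix_lengths {d : ℕ} {S : EuclidState} {x : ℝ × ℝ}
    (h : ∀ i, 0 ≤ S.lengths d x i) :
    (CurveTwo.jac ⟨.theta, fun i => (S.lengths d x i).toNNReal⟩).HasMatrix (S.matrix d x) := by
  have := hasMatrix_of_mem_sigmaCone (matrix_mem_sigmaCone h)
  rwa [lengths_eq] at this

/-- The two inequalities of the sector are the signs of the first length and of the deciding one;
the third length is nonnegative on the whole quadrant. -/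
theorem lengths_nonneg_of_mem_sector {d : ℕ} {S : EuclidState} (hS : S.IsPos) {n : ℕ}
    {x : ℝ × ℝ} (hx : x ∈ sector (fun n => (next^[n] S).vec) n (n + 1)) (i : Fin 3) :
    0 ≤ (next^[n] S).lengths d x i := by
  obtain ⟨hq, h1, h2⟩ := hx
  have hd : (0 : ℝ) ≤ (d : ℝ)⁻¹ := by positivity
  dsimp only at h1 h2
  rw [iterate_succ] at h2
  rcases eq_or_ne i 0 with rfl | h0
  · rw [lengths_zero]
    exact neg_nonneg.2 (mul_nonpos_of_nonneg_of_nonpos hd h1)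
  · rcases eq_or_ne i (next^[n] S).index with rfl | hi
    · rw [lengths_index]
      exact mul_nonneg hd h2
    · exact lengths_nonneg (hS.iterate n) hq h0 hi

theorem lengths_zero_pos {d : ℕ} (hd : d ≠ 0) {S : EuclidState} {x : ℝ × ℝ}
    (h : crossForm S.vec x < 0) : 0 < S.lengths d x 0 := by
  rw [lengths_zero]
  exact neg_pos.2 (mul_neg_of_pos_of_neg (by positivity) h)

theorem lengths_index_pos {d : ℕ} (hd : d ≠ 0) {S : EuclidState} {x : ℝ × ℝ}
    (h : 0 < crossForm S.next.vec x) : 0 < S.lengths d x S.index := by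
  rw [lengths_index]
  exact mul_pos (by positivity) h

theorem lengths_pos_of_mem_openSector {d : ℕ} (hd : d ≠ 0) {S : EuclidState} (hS : S.IsPos) {n : ℕ}
    {x : ℝ × ℝ} (hx : x ∈ openSector (fun n => (next^[n] S).vec) n) (i : Fin 3) :
    0 < (next^[n] S).lengths d x i := by
  obtain ⟨hq, h1, h2⟩ := hx
  dsimp only at h1 h2
  rw [iterate_succ] at h2
  rcases eq_or_ne i 0 with rfl | h0
  · exact lengths_zero_pos hd h1
  · rcases eq_or_ne i (next^[n] S).index with rfl | hi
    · exact lengths_index_pos hd h2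
    · exact lengths_pos hd (hS.iterate n) hq h0 hi

/-- Two of the lengths are nonzero multiples of the cross forms of consecutive rays, which by
Cramer's rule determine the point. -/
theorem lengths_injective {d : ℕ} (hd : d ≠ 0) {N : ℕ} {S : EuclidState}
    (hv : IsRaySequence N fun n => (next^[n] S).vec) {n : ℕ} (hn : n ≤ N) :
    Function.Injective ((next^[n] S).lengths d) := by
  have hd' : (d : ℝ)⁻¹ ≠ 0 := by positivity
  refine (injective_iff_map_eq_zero _).2 fun x hx => ?_
  have h0 := congrFun hx 0
  have h1 := congrFun hx (next^[n] S).index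
  rw [lengths_zero, Pi.zero_apply, neg_eq_zero, mul_eq_zero, or_iff_right hd'] at h0
  rw [lengths_index, Pi.zero_apply, mul_eq_zero, or_iff_right hd', ← iterate_succ] at h1
  rw [hv.eq_add_of_crossForm hn x]
  rw [h0, h1]
  simp

theorem finrank_span_lengths {d : ℕ} (hd : d ≠ 0) {N : ℕ} {S : EuclidState}
    (hv : IsRaySequence N fun n => (next^[n] S).vec) {n : ℕ} (hn : n ≤ N) :
    Module.finrank ℝ (Submodule.span ℝ
      ((next^[n] S).lengths d '' openSector (fun n => (next^[n] S).vec) n)) = 2 := by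
  have htop : Submodule.span ℝ (openSector (fun n => (next^[n] S).vec) n) = ⊤ := by
    apply Submodule.eq_top_of_nonempty_interior'
    obtain ⟨x, hx⟩ := hv.openSector_nonempty hn
    exact ⟨x, interior_maximal Submodule.subset_span (isOpen_openSector _ n) hx⟩
  rw [← Submodule.map_span, htop, ← LinearMap.range_eq_map,
    LinearMap.finrank_range_of_inj (lengths_injective hd hv hn)]
  simp

end EuclidState

/-! ### The pieces of the locus -/

section Piece

open EuclidState

variable {d : ℕ} {k : (ZMod d)ˣ} {N : ℕ}

theorem val_unit_pos (hd : 2 ≤ d) (k : (ZMod d)ˣ) : 0 < (k : ZMod d).val := by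
  have : Fact (1 < d) := ⟨hd⟩
  exact Nat.pos_of_ne_zero fun h => k.ne_zero ((ZMod.val_eq_zero _).1 h)

theorem val_unit_lt (hd : 2 ≤ d) (k : (ZMod d)ˣ) : (k : ZMod d).val < d := by
  have : NeZero d := ⟨by omega⟩
  exact ZMod.val_lt _

/-- The rays of the fan `Δ_k`. -/
def splitRay (d : ℕ) (k : (ZMod d)ˣ) (n : ℕ) : ℤ × ℤ := (next^[n] (start d (k : ZMod d).val)).vec

/-- The types that occur. -/
def splitWord (d : ℕ) (k : (ZMod d)ˣ) (n : ℕ) : List SellingMove :=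
  (start d (k : ZMod d).val).word n

theorem isPos_start (hd : 2 ≤ d) (k : (ZMod d)ˣ) : (start d (k : ZMod d).val).IsPos :=
  start_isPos (val_unit_pos hd k) (val_unit_lt hd k)

/-- The lengths of the theta curve for the type `w`. -/
noncomputable def typeLengths (d : ℕ) (k : (ZMod d)ˣ) (w : List SellingMove) :
    ℝ × ℝ →ₗ[ℝ] (Fin 3 → ℝ) :=
  (next^[w.length] (start d (k : ZMod d).val)).lengths d

theorem typeLengths_splitWord (n : ℕ) : typeLengths d k (splitWord d k n) =
    (next^[n] (start d (k : ZMod d).val)).lengths d := by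
  rw [typeLengths, splitWord, length_word]

theorem hasMatrix_typeLengths (hd : 2 ≤ d) {n : ℕ} {x : ℝ × ℝ}
    (hx : x ∈ sector (splitRay d k) n (n + 1)) :
    (CurveTwo.jac ⟨.theta, fun i => (typeLengths d k (splitWord d k n) x i).toNNReal⟩).HasMatrix
      (Qpp d k x) := by
  rw [typeLengths_splitWord, ← matrix_start (by omega)]
  exact hasMatrix_of_iterate n
    (theta_hasMatrix_lengths (lengths_nonneg_of_mem_sector (isPos_start hd k) hx))

/-- Any matrix in `σ` of the same class belongs to a theta curve with the same lengths up to order.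
Hence whether some Selling parameter vanishes does not depend on the reduced matrix chosen. -/
theorem mem_walls_iff_of_mem_sector (hd : 2 ≤ d) {n : ℕ} {x : ℝ × ℝ} (hx' : x ∈ openQuadrant)
    (hx : x ∈ sector (splitRay d k) n (n + 1)) :
    x ∈ walls d k ↔ ∃ i, typeLengths d k (splitWord d k n) x i = 0 := by
  have hnn := lengths_nonneg_of_mem_sector (d := d) (isPos_start hd k) hx
  have hm := hasMatrix_typeLengths hd hx
  rw [typeLengths_splitWord] at hm ⊢
  set S := next^[n] (start d (k : ZMod d).val)
  constructor
  · rintro ⟨-, a, ⟨Q, hQ, hz, ha⟩, ha'⟩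
    obtain ⟨T, rfl⟩ := Quotient.exists_rep a
    rw [show (⟦T⟧ : Quotient pptavSetoid) = Quotient.mk pptavSetoid T from rfl,
      isClassOf_mk_iff] at ha ha'
    obtain ⟨π, hπ⟩ := eq_comp_perm_of_iso
      (PPTav.iso_equivalence.trans ((hasMatrix_of_mem_sigmaCone hQ).iso ha) (ha'.iso hm))
    obtain ⟨j, hj⟩ : ∃ j : Fin 3, ![-Q 0 1, -selling13 Q, -selling23 Q] j = 0 := by
      rcases hz with h | h | h
      · exact ⟨0, by simp [h]⟩
      · exact ⟨1, by simp [h]⟩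
      · exact ⟨2, by simp [h]⟩
    have h := congrFun hπ j
    simp only [Function.comp_apply, hj, Real.toNNReal_zero] at h
    exact ⟨π j, le_antisymm (Real.toNNReal_eq_zero.1 h.symm) (hnn _)⟩
  · rintro ⟨i, hi⟩
    have hσ := matrix_mem_sigmaCone hnn
    refine ⟨hx', torelli (thetaCurve fun i => (S.lengths d x i).toNNReal),
      ⟨S.matrix d x, hσ, ?_, ?_⟩, ?_⟩
    · rw [matrix_zero_one, selling13_matrix, selling23_matrix, neg_eq_zero, neg_eq_zero,
        neg_eq_zero]
      fin_cases i
      · exact Or.inl hi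
      · exact Or.inr (Or.inl hi)
      · exact Or.inr (Or.inr hi)
    · exact mk_mem_torelliFibre.2 (theta_hasMatrix_lengths hnn)
    · exact mk_mem_torelliFibre.2 hm

theorem walls_eq (hd : 2 ≤ d) (hv : IsRaySequence N (splitRay d k)) :
    walls d k = {x ∈ openQuadrant | ∃ j, 1 ≤ j ∧ j ≤ N ∧ crossForm (splitRay d k j) x = 0} := by
  have hd0 : d ≠ 0 := by omega
  ext x
  constructor
  · intro hx
    by_contra hcon
    have hxo : x ∈ openQuadrant := hx.1
    obtain ⟨i, hi, h⟩ := hv.exists_mem_openSector ⟨hxo, hcon⟩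
    obtain ⟨j, hj⟩ := (mem_walls_iff_of_mem_sector hd hxo (openSector_subset_sector _ i h)).1 hx
    rw [typeLengths_splitWord] at hj
    exact (lengths_pos_of_mem_openSector hd0 (isPos_start hd k) h j).ne' hj
  · rintro ⟨hx, j, -, hj, h⟩
    have hm : x ∈ sector (splitRay d k) j (j + 1) :=
      ⟨openQuadrant_subset hx, h.le,
        hv.crossForm_nonneg_of_le j.le_succ (by omega) (openQuadrant_subset hx) h.ge⟩
    refine (mem_walls_iff_of_mem_sector hd hx hm).2 ⟨0, ?_⟩
    change crossForm (next^[j] (start d (k : ZMod d).val)).vec x = 0 at h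
    rw [typeLengths_splitWord, lengths_zero, h, mul_zero, neg_zero]

theorem maximalCones_eq (hd : 2 ≤ d) (hv : IsRaySequence N (splitRay d k)) :
    maximalCones d k = {C | ∃ i ≤ N, C = sector (splitRay d k) i (i + 1)} := by
  rw [maximalCones, walls_eq hd hv]
  exact hv.closures_eq

theorem splitFan_eq (hd : 2 ≤ d) (hv : IsRaySequence N (splitRay d k)) :
    splitFan d k = {F | ∃ i ≤ N, IsFace F (sector (splitRay d k) i (i + 1))} := by
  rw [splitFan, maximalCones_eq hd hv]
  ext F
  constructor
  · rintro ⟨_, ⟨i, hi, rfl⟩, h⟩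
    exact ⟨i, hi, h⟩
  · rintro ⟨i, hi, h⟩
    exact ⟨_, ⟨i, hi, rfl⟩, h⟩

/-- From `p₂ = 0` on, the vectors stay on the first axis, where the cross form is positive on the
open quadrant; this bounds the number of moves by `N`. -/
theorem exists_isRaySequence_splitRay (hd : 2 ≤ d) (k : (ZMod d)ˣ) :
    ∃ N, IsRaySequence N (splitRay d k) ∧
      ∀ n, N < n → ∀ x ∈ openQuadrant, 0 < crossForm (splitRay d k n) x := by
  obtain ⟨N, hv, hN⟩ := exists_isRaySequence (val_unit_pos hd k) (val_unit_lt hd k)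
  refine ⟨N, hv, fun n hn x hx => ?_⟩
  have h1 := s₁_pos (val_unit_pos hd k) (val_unit_lt hd k) (by omega : 1 ≤ n)
  have h2 := ((isPos_start hd k).iterate n).s₂
  have h3 : (0 : ℝ) < ((next^[n] (start d (k : ZMod d).val)).s₁ *
    (next^[n] (start d (k : ZMod d).val)).s₂ : ℤ) := by exact_mod_cast mul_pos h1 h2
  rw [crossForm_apply, splitRay, vec, hN n hn, mul_zero, Int.cast_zero, zero_mul, sub_zero]
  exact mul_pos h3 hx.2

theorem exists_eq_splitWord (hd : 2 ≤ d)
    (hN : ∀ n, N < n → ∀ x ∈ openQuadrant, 0 < crossForm (splitRay d k n) x)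
    {w : List SellingMove} {x : ℝ × ℝ} (hx : x ∈ typeRegion d k w) :
    ∃ n ≤ N, w = splitWord d k n ∧ 0 ≤ crossForm (splitRay d k (n + 1)) x ∧
      (n ≠ 0 → crossForm (splitRay d k n) x < 0) := by
  obtain ⟨hx, h⟩ := hx
  rw [← matrix_start (by omega)] at h
  obtain ⟨n, rfl, h1, h2⟩ := exists_eq_word (by omega) hx (isPos_start hd k) h
  refine ⟨n, ?_, rfl, h1, h2⟩
  by_contra! hn
  exact absurd (h2 (by omega)) (hN n hn x hx).not_gt

theorem openSector_subset_typeRegion (hd : 2 ≤ d) (hv : IsRaySequence N (splitRay d k)) {n : ℕ}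
    (hn : n ≤ N) : openSector (splitRay d k) n ⊆ typeRegion d k (splitWord d k n) := by
  rintro x ⟨hx, h1, h2⟩
  refine ⟨hx, ?_⟩
  rw [← matrix_start (by omega)]
  refine hasSellingType_word (by omega) hx n (isPos_start hd k) (fun j _ hj' => ?_) h2.le
  by_contra! h
  exact absurd h1 (hv.crossForm_nonneg_of_le hj' (by omega) (openQuadrant_subset hx) h).not_gt

theorem splitWord_injective : Function.Injective (splitWord d k) := fun m n h => by
  have := congrArg List.length h
  rwa [splitWord, splitWord, length_word, length_word] at this

/-- The region is the sector without the ray `n`: on a ray the algorithm has already stopped, so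
inner rays belong to the shorter of the two types. -/
theorem typeCone_splitWord (hd : 2 ≤ d) (hv : IsRaySequence N (splitRay d k))
    (hN : ∀ n, N < n → ∀ x ∈ openQuadrant, 0 < crossForm (splitRay d k n) x) {n : ℕ}
    (hn : n ≤ N) : typeCone d k (splitWord d k n) = sector (splitRay d k) n (n + 1) := by
  refine hv.closure_eq_sector hn (openSector_subset_typeRegion hd hv hn) fun x hx => ?_
  obtain ⟨m, -, hm, h1, h2⟩ := exists_eq_splitWord hd hN hx
  obtain rfl := splitWord_injective hm
  refine ⟨openQuadrant_subset hx.1, ?_, h1⟩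
  rcases eq_or_ne n 0 with rfl | h0
  · exact (hv.crossForm_zero_neg hx.1).le
  · exact (h2 h0).le

theorem isFeasible_iff (hd : 2 ≤ d) (hv : IsRaySequence N (splitRay d k))
    (hN : ∀ n, N < n → ∀ x ∈ openQuadrant, 0 < crossForm (splitRay d k n) x)
    {w : List SellingMove} : IsFeasible d k w ↔ ∃ n ≤ N, w = splitWord d k n := by
  constructor
  · rintro ⟨x, hx⟩
    obtain ⟨n, hn, h, -⟩ := exists_eq_splitWord hd hN hx
    exact ⟨n, hn, h⟩
  · rintro ⟨n, hn, rfl⟩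
    exact (hv.openSector_nonempty hn).mono (openSector_subset_typeRegion hd hv hn)

theorem bijOn_typeCone (hd : 2 ≤ d) (hv : IsRaySequence N (splitRay d k))
    (hN : ∀ n, N < n → ∀ x ∈ openQuadrant, 0 < crossForm (splitRay d k n) x) :
    Set.BijOn (typeCone d k) {w | IsFeasible d k w} (maximalCones d k) := by
  rw [maximalCones_eq hd hv]
  refine ⟨fun w hw => ?_, fun w hw w' hw' h => ?_, ?_⟩
  · obtain ⟨n, hn, rfl⟩ := (isFeasible_iff hd hv hN).1 hw
    exact ⟨n, hn, typeCone_splitWord hd hv hN hn⟩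
  · obtain ⟨n, hn, rfl⟩ := (isFeasible_iff hd hv hN).1 hw
    obtain ⟨m, hm, rfl⟩ := (isFeasible_iff hd hv hN).1 hw'
    rw [typeCone_splitWord hd hv hN hn, typeCone_splitWord hd hv hN hm] at h
    rw [hv.sector_injective hn hm h]
  · rintro _ ⟨n, hn, rfl⟩
    exact ⟨splitWord d k n, (isFeasible_iff hd hv hN).2 ⟨n, hn, rfl⟩,
      typeCone_splitWord hd hv hN hn⟩

/-- On the common ray of two adjacent cones, exactly one of the three lengths vanishes. -/
theorem exists_lengths_eq_zero (hd : 2 ≤ d) (hv : IsRaySequence N (splitRay d k)) {n m : ℕ}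
    (hn : n ≤ N) (hm : m ≤ N) (hne : n ≠ m) {x₀ : ℝ × ℝ} (h0 : x₀ ≠ 0)
    (h1 : x₀ ∈ sector (splitRay d k) n (n + 1)) (h2 : x₀ ∈ sector (splitRay d k) m (m + 1)) :
    ∃ j : Fin 3, ∀ x ∈ sector (splitRay d k) n (n + 1) ∩ sector (splitRay d k) m (m + 1),
      typeLengths d k (splitWord d k n) x j = 0 ∧
      (x ≠ 0 → ∀ i, i ≠ j → 0 < typeLengths d k (splitWord d k n) x i) := by
  have hd0 : d ≠ 0 := by omega
  have hS := (isPos_start hd k).iterate n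
  rw [typeLengths_splitWord]
  rcases hne.lt_or_gt with hlt | hlt
  · obtain rfl := hv.eq_succ_of_mem_sector hlt hm h0 h1 h2
    -- Seen from the sector before the ray, the deciding length vanishes; seen from the sector after
    -- it, in the other case below, the length with index `0` does.
    refine ⟨(next^[n] (start d (k : ZMod d).val)).index, fun x ⟨hx, hx'⟩ => ?_⟩
    have hz : crossForm (splitRay d k (n + 1)) x = 0 := le_antisymm hx'.2.1 hx.2.2
    refine ⟨?_, fun hx0 i hi => ?_⟩
    · rw [lengths_index, ← iterate_succ]
      exact mul_eq_zero_of_right _ hz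
    · have hxo := hv.mem_openQuadrant_of_crossForm_eq_zero (by omega) hm hx.1 hx0 hz
      rcases eq_or_ne i 0 with rfl | hi0
      · refine lengths_zero_pos hd0 ?_
        by_contra! h
        exact (hv.crossForm_pos_of_lt n.lt_succ_self (by omega) hx.1 hx0 h).ne' hz
      · exact lengths_pos hd0 hS hxo hi0 hi
  · obtain rfl := hv.eq_succ_of_mem_sector hlt hn h0 h2 h1
    refine ⟨0, fun x ⟨hx, hx'⟩ => ?_⟩
    have hz : crossForm (splitRay d k (m + 1)) x = 0 := le_antisymm hx.2.1 hx'.2.2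
    refine ⟨?_, fun hx0 i hi => ?_⟩
    · rw [lengths_zero]
      exact neg_eq_zero.2 (mul_eq_zero_of_right _ hz)
    · have hxo := hv.mem_openQuadrant_of_crossForm_eq_zero (by omega) hn hx.1 hx0 hz
      rcases eq_or_ne i (next^[m + 1] (start d (k : ZMod d).val)).index with rfl | hi'
      · refine lengths_index_pos hd0 ?_
        rw [← iterate_succ]
        exact hv.crossForm_pos_of_lt (m + 1).lt_succ_self (by omega) hx.1 hx0 hz.ge
      · exact lengths_pos hd0 hS hxo hi hi'

end Piece

/-! ### The theorem -/

theorem mainTheorem2 (d : ℕ) (hd : 2 ≤ d) :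
    Nat.card (ZMod d)ˣ = Nat.totient d ∧
    splitLocus d = (⋃ k : (ZMod d)ˣ, splitPiece d k) ∧
    ∀ k : (ZMod d)ˣ,
      IsFan (splitFan d k) ∧
      ⋃₀ splitFan d k = closedQuadrant ∧
      Set.BijOn (typeCone d k) {w | IsFeasible d k w} (maximalCones d k) ∧
      ∃ φ : List SellingMove → (ℝ × ℝ →ₗ[ℝ] (Fin 3 → ℝ)),
        (∀ w, IsFeasible d k w →
          (∀ x ∈ typeCone d k w, ∀ i, 0 ≤ φ w x i) ∧
          (∀ x ∈ interior (typeCone d k w),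
            (∀ i, 0 < φ w x i) ∧
            torelliFibre (Qpp d k x) = {thetaCurve fun i => (φ w x i).toNNReal}) ∧
          Module.finrank ℝ (Submodule.span ℝ (φ w '' interior (typeCone d k w))) = 2) ∧
        (∀ w w', IsFeasible d k w → IsFeasible d k w' → w ≠ w' →
          ∀ r, IsFace r (typeCone d k w) → IsFace r (typeCone d k w') →
          Module.finrank ℝ (Submodule.span ℝ r) = 1 →
          ∃ m : Fin 3, ∀ x ∈ r,
            φ w x m = 0 ∧
            (x ≠ 0 → 0 < φ w x (m + 1) ∧ 0 < φ w x (m + 2)) ∧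
            (thetaCurve fun i => (φ w x i).toNNReal) =
              dumbbellCurve ![(φ w x (m + 1)).toNNReal, (φ w x (m + 2)).toNNReal, 0] ∧
            (x ≠ 0 → torelliFibre (Qpp d k x) = Set.range fun t : NNReal =>
              dumbbellCurve ![(φ w x (m + 1)).toNNReal, (φ w x (m + 2)).toNNReal, t])) ∧
        (∀ w w', IsFeasible d k w → IsFeasible d k w' →
          ∀ x ∈ typeCone d k w ∩ typeCone d k w',
            (thetaCurve fun i => (φ w x i).toNNReal) =
              thetaCurve fun i => (φ w' x i).toNNReal) := by
  refine ⟨?_, splitLocus_eq (by omega), fun k => ?_⟩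
  · have : NeZero d := ⟨by omega⟩
    rw [Nat.card_eq_fintype_card, ZMod.card_units_eq_totient]
  obtain ⟨N, hv, hN⟩ := exists_isRaySequence_splitRay hd k
  refine ⟨?_, ?_, bijOn_typeCone hd hv hN, typeLengths d k, fun w hw => ?_,
    fun w w' hw hw' hne r hr hr' hrank => ?_, fun w w' hw hw' x hx => ?_⟩
  · rw [splitFan_eq hd hv]
    exact hv.isFan
  · rw [splitFan_eq hd hv]
    exact hv.sUnion_faces
  · obtain ⟨n, hn, rfl⟩ := (isFeasible_iff hd hv hN).1 hw
    rw [typeCone_splitWord hd hv hN hn, hv.interior_sector hn]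
    refine ⟨fun x hx i => ?_, fun x hx => ?_, ?_⟩
    · rw [typeLengths_splitWord]
      exact EuclidState.lengths_nonneg_of_mem_sector (isPos_start hd k) hx i
    · have hpos : ∀ i, 0 < typeLengths d k (splitWord d k n) x i := fun i => by
        rw [typeLengths_splitWord]
        exact EuclidState.lengths_pos_of_mem_openSector (by omega) (isPos_start hd k) hx i
      exact ⟨hpos, torelliFibre_of_pos
        (hasMatrix_typeLengths hd (openSector_subset_sector _ n hx))
        fun i => Real.toNNReal_pos.2 (hpos i)⟩
    · rw [typeLengths_splitWord]
      exact EuclidState.finrank_span_lengths (by omega) hv hn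
  · obtain ⟨n, hn, rfl⟩ := (isFeasible_iff hd hv hN).1 hw
    obtain ⟨m, hm, rfl⟩ := (isFeasible_iff hd hv hN).1 hw'
    rw [typeCone_splitWord hd hv hN hn] at hr
    rw [typeCone_splitWord hd hv hN hm] at hr'
    obtain ⟨f, -, hf⟩ := hr
    obtain ⟨f', -, hf'⟩ := hr'
    have hsub : ∀ x ∈ r, x ∈ sector (splitRay d k) n (n + 1) ∩ sector (splitRay d k) m (m + 1) :=
      fun x hx => ⟨(hf ▸ hx : x ∈ {x ∈ _ | f x = 0}).1, (hf' ▸ hx : x ∈ {x ∈ _ | f' x = 0}).1⟩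
    -- Dimension `1` rules out the origin as the common face; a nonzero common vector forces the
    -- sectors to be neighbours.
    obtain ⟨x₀, hx₀, h0⟩ : ∃ x ∈ r, x ≠ 0 := by
      by_contra! h
      rw [Submodule.span_eq_bot.2 h, finrank_bot] at hrank
      exact absurd hrank (by decide)
    obtain ⟨j, hj⟩ := exists_lengths_eq_zero hd hv hn hm (fun h => hne (by rw [h])) h0
      (hsub x₀ hx₀).1 (hsub x₀ hx₀).2
    refine ⟨j, fun x hx => ?_⟩
    obtain ⟨hz, hpos⟩ := hj x (hsub x hx)
    have hz' : (typeLengths d k (splitWord d k n) x j).toNNReal = 0 := by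
      rw [hz, Real.toNNReal_zero]
    have hpos' : x ≠ 0 → 0 < typeLengths d k (splitWord d k n) x (j + 1) ∧
        0 < typeLengths d k (splitWord d k n) x (j + 2) := fun hx0 =>
      ⟨hpos hx0 _ (by omega), hpos hx0 _ (by omega)⟩
    exact ⟨hz, hpos', thetaCurve_eq_dumbbellCurve hz', fun hx0 =>
      torelliFibre_of_eq_zero (hasMatrix_typeLengths hd (hsub x hx).1) hz'
        (Real.toNNReal_pos.2 (hpos' hx0).1) (Real.toNNReal_pos.2 (hpos' hx0).2)⟩
  · obtain ⟨n, hn, rfl⟩ := (isFeasible_iff hd hv hN).1 hw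
    obtain ⟨m, hm, rfl⟩ := (isFeasible_iff hd hv hN).1 hw'
    rw [typeCone_splitWord hd hv hN hn, typeCone_splitWord hd hv hN hm] at hx
    -- Both theta curves have a Jacobian with matrix `Qpp d k x`, so they coincide by the Torelli
    -- statement for theta curves.
    exact thetaCurve_eq_of_hasMatrix (hasMatrix_typeLengths hd hx.1)
      (hasMatrix_typeLengths hd hx.2)
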